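/- Let $S$ be a closed connected topological surface with a finite cellular (CW) decomposition $\Sigma=(V,E,F)$, and let $\Phi: E\to(0,\frac{\pi}{2})$ be a weight. For an edge $e$ let $f_1(e),f_2(e)\in F$ be the (possibly equal) faces on its two sides; for $A\subset F$ let $E_A$ be the set of edges with at least one of $f_1(e),f_2(e)$ in $A$. A vector $k\in\mathbb{R}_{\ge 0}^{F}$ is regarded as the spherical conical metric on $S$ whose circle pattern has a disk of radius $r_i=\operatorname{arccot} k_i\in(0,\frac{\pi}{2}]$ (hence of boundary geodesic curvature $k_i$) for each face $i$, and in which the disks of $f_1(e)$ and $f_2(e)$ overlap, for each edge $e$, in a spherical bigon of interior angle $\Phi(e)$ (metrics that are isometric, compatibly with their circle patterns and isotopically to the identity, have the same $k$). The metric is called a degenerated circle pattern metric if some $k_i=0$. For such $k$, the bigon of $e$ is the intersection of two disks of radii $r_{f_1(e)},r_{f_2(e)}$ in the unit sphere $\mathbb{S}^2$ whose interior angle is $\Phi(e)$; the total geodesic curvature of its side on the circle of the face $i$ is $k_i$ times the length of that side, and the total geodesic curvature $L_i(k)$ of the face $i$ is the sum of these numbers over all bigon sides that belong to $i$ (both sides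 of the bigon of $e$ if $f_1(e)=f_2(e)=i$). Let $I\subset F$ with $I\ne\emptyset$ and $I\ne F$. Put $$\mathbb{R}^{F}_{I}=\{k\in\mathbb{R}^{F} : k_i>0 \text{ for } i\in I,\ k_i=0 \text{ for } i\notin I\},$$ $$\mathcal{L}_{I}=\Big\{L\in\mathbb{R}^{F}_{I} : \sum_{f\in A}L_f<2\sum_{e\in E_{A}}\Phi(e)\ \text{ for all } \emptyset\ne A\subset I\Big\}.$$ Let $\hat L\in\mathcal{L}_{I}$. Then there is exactly one degenerated circle pattern metric $\hat k$ with total geodesic curvature $L(\hat k)=\hat L$, and $\hat k\in\mathbb{R}^{F}_{I}$. For every initial value $k(0)\in\mathbb{R}_{>0}^{F}$, the prescribed combinatorial Ricci flow $$\frac{dk_i}{dt}=-(L_i(k)-\hat L_i)\,k_i\quad(i\in I),\qquad \frac{dk_i}{dt}=-L_i(k)\,k_i\quad(i\in F\setminus I)$$ has a solution $k(t)\in\mathbb{R}_{>0}^{F}$ for all $t\in[0,\infty)$; it is unique (every solution with the same initial value on an interval $[0,T)$ agrees with it there), and $k(t)\to\hat k$ as $t\to\infty$. In particular $k_i(t)\to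 0$ for every $i\in F\setminus I$. -/

import Mathlib

open Set Filter Topology MeasureTheory

noncomputable section

namespace CirclePattern

/-! ### Cellular decompositions of surfaces -/

/-- The 1-cells of a CW structure on the whole space `S`. -/
abbrev Edges (S : Type*) [TopologicalSpace S] [CWComplex (univ : Set S)] : Type _ :=
  RelCWComplex.cell (univ : Set S) 1

/-- The 2-cells of a CW structure on the whole space `S`. -/
abbrev Faces (S : Type*) [TopologicalSpace S] [CWComplex (univ : Set S)] : Type _ :=
  RelCWComplex.cell (univ : Set S) 2

/-- `f₁` and `f₂` are the 2-cells on the two sides of the 1-cell `e`: the open 1-cell `e` has an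
open neighbourhood homeomorphic to the plane, in which `e` is the horizontal axis, the upper half
plane lies in `f₁` and the lower half plane lies in `f₂`. The case `f₁ = f₂` is allowed. -/
def LieOnTwoSides {S : Type*} [TopologicalSpace S] [CWComplex (univ : Set S)]
    (e : Edges S) (f₁ f₂ : Faces S) : Prop :=
  ∃ ψ : ℝ × ℝ → S, IsOpenEmbedding ψ ∧
    ψ '' {z | z.2 = 0} = RelCWComplex.openCell 1 e ∧
    ψ '' {z | 0 < z.2} ⊆ RelCWComplex.openCell 2 f₁ ∧
    ψ '' {z | z.2 < 0} ⊆ RelCWComplex.openCell 2 f₂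

/-! ### Spherical bigons -/

/-- The point of the unit sphere at spherical distance `r` from the pole `p = (0, 0, 1)`, in the
tangent direction `(cos α, sin α, 0)` at `p`. -/
def fromPole (α r : ℝ) : EuclideanSpace ℝ (Fin 3) :=
  !₂[Real.sin r * Real.cos α, Real.sin r * Real.sin α, Real.cos r]

/-- The open spherical disk of radius `r` around a point `c` of the unit sphere. -/
def sphericalDisk (c : EuclideanSpace ℝ (Fin 3)) (r : ℝ) : Set (EuclideanSpace ℝ (Fin 3)) :=
  {x | ‖x‖ = 1 ∧ InnerProductGeometry.angle c x < r}

/-- The boundary circle of the spherical disk of radius `r` around `fromPole 0 r`, parametrized by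
the angle at the centre. The last two vectors are an orthonormal basis of the tangent plane at the
centre, and the parameter `0` gives the pole `p`. -/
def boundaryCircle (r θ : ℝ) : EuclideanSpace ℝ (Fin 3) :=
  Real.cos r • fromPole 0 r +
    Real.sin r • (Real.cos θ • !₂[-Real.cos r, 0, Real.sin r] + Real.sin θ • !₂[0, 1, 0])

/-- Let `D`, `D'` be disks of radii `r`, `r'` on the unit sphere whose boundaries pass through the
pole `p` and whose centres are seen from `p` in directions that make the angle `π - φ`. Then
`D ∩ D'` is a bigon with a vertex at `p` and with interior angle `φ`. This is the length of its side
on `∂D`, that is, of the arc of `∂D` inside `D'`. (The other side has length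
`bigonSideLength φ r' r`, by reflection.) -/
def bigonSideLength (φ r r' : ℝ) : ℝ :=
  ∫ θ in {θ | θ ∈ Ioc (-Real.pi) Real.pi ∧
      boundaryCircle r θ ∈ sphericalDisk (fromPole (Real.pi - φ) r') r'},
    ‖deriv (boundaryCircle r) θ‖

/-- The radius `r = arccot k` of a disk whose boundary has geodesic curvature `k = cot r`; it lies in
`(0, π/2]` for `k ≥ 0`. -/
def radius (k : ℝ) : ℝ := Real.pi / 2 - Real.arctan k

/-- The total geodesic curvature of the side, on the circle of geodesic curvature `k`, of a bigon of
angle `φ` between disks with geodesic curvatures `k` and `k'`. -/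
def sideCurvature (φ k k' : ℝ) : ℝ := bigonSideLength φ (radius k) (radius k') * k

/-! ### Total geodesic curvatures and flows

`E` and `F` are the sets of edges and faces, `f₁ e` and `f₂ e` are the faces on the two sides of the
edge `e`, and `Φ` is the weight. A metric is given by its vector `k` of geodesic curvatures. -/

section Combinatorial

variable {E F : Type*} [Fintype E] [DecidableEq F]

/-- The total geodesic curvature of the face `i`: the sum over all bigon sides belonging to `i`. If
`i` is on both sides of `e`, both sides of the bigon of `e` count. -/
def totalCurvature (f₁ f₂ : E → F) (Φ : E → ℝ) (k : F → ℝ) (i : F) : ℝ :=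
  ∑ e, ((if f₁ e = i then sideCurvature (Φ e) (k i) (k (f₂ e)) else 0) +
    (if f₂ e = i then sideCurvature (Φ e) (k i) (k (f₁ e)) else 0))

/-- The edges that are on the boundary of some face of `A`. -/
def boundaryEdges (f₁ f₂ : E → F) (A : Finset F) : Finset E :=
  Finset.univ.filter fun e => f₁ e ∈ A ∨ f₂ e ∈ A

/-- The set `𝓛_I` of prescribed total geodesic curvatures supported on the set of faces `I`. -/
def prescribedCurvatures (f₁ f₂ : E → F) (Φ : E → ℝ) (I : Finset F) : Set (F → ℝ) :=
  {L | (∀ i ∈ I, 0 < L i) ∧ (∀ i ∉ I, L i = 0) ∧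
    ∀ A ⊆ I, A.Nonempty → ∑ f ∈ A, L f < 2 * ∑ e ∈ boundaryEdges f₁ f₂ A, Φ e}

/-- `k` solves, on the time interval `J` and within the positive vectors, the prescribed
combinatorial Ricci flow for `Lhat` on the faces in `I` and for `0` on the other faces. -/
def IsFlowOn (f₁ f₂ : E → F) (Φ : E → ℝ) (I : Finset F) (Lhat : F → ℝ)
    (J : Set ℝ) (k : ℝ → F → ℝ) : Prop :=
  ∀ t ∈ J, ∀ i, 0 < k t i ∧
    HasDerivWithinAt (fun s => k s i)
      (if i ∈ I then -(totalCurvature f₁ f₂ Φ (k t) i - Lhat i) * k t i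
        else -totalCurvature f₁ f₂ Φ (k t) i * k t i) J t

end Combinatorial

/-- Degenerated circle pattern metrics: nonnegative geodesic curvatures, at least one of them `0`. -/
def IsDegenerated {F : Type*} (k : F → ℝ) : Prop := (∀ i, 0 ≤ k i) ∧ ∃ i, k i = 0

/-- The vectors that are positive on `I` and `0` elsewhere. -/
def stratum {F : Type*} (I : Finset F) : Set (F → ℝ) :=
  {k | (∀ i ∈ I, 0 < k i) ∧ ∀ i ∉ I, k i = 0}

end CirclePattern

end

/-! ### The faces of a surface with at least two faces have edges -/

/-! For k > 0 a bigon side has total curvature 2 s arccot(s Y), with s = k / √(1 + k²) and Y = (k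
cos φ + k') / (k sin φ) (`sideCurvature_eq`, `sideFormula_eq`). This decreases in the opposite
curvature k' and, since x arccot x is increasing, strictly increases when k and k' are scaled up
together (`sideFormula_lt_scale`). Hence L_i does not rise when only other coordinates rise, and
L_i(c k) > L_i(k) for c > 1 if k_i > 0 and the face i has an edge. Everything else is comparison
based on these two facts.

Existence is Perron's method: vectors supported on I with L ≤ Lhat there are closed under joins, and
their supremum solves L = Lhat. The supremum is finite: if the curvatures on A ⊆ I grew without
bound while the others stayed bounded, each edge of E_A would contribute at least nearly 2Φ(e)
(`sum_edgeLowerBound_le`), against the inequality for A in the definition of 𝓛_I.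

In the coordinates log k the flow has a bounded, globally Lipschitz field, so solutions are global
and unique. For any degenerated solution k̂ of L = Lhat, the multiple c k̂ with c < 1 is a strict
subsolution on I; with c > 1, and small positive values in place of the zeros, it becomes a strict
supersolution. A maximum principle for log k - log l forces every trajectory towards k̂
(`tendsto_exp_of_curvatureFormula_eq`). Uniqueness of k̂ follows, because one trajectory has only
one limit.

Topology serves only to give every face an edge (`exists_edge_of_face`): otherwise the closure of
the face would be clopen. -/

theorem isPreconnected_ball_diff_center {E : Type*} [NormedAddCommGroup E] [InnerProductSpace ℝ E]
    (h : 1 < Module.rank ℝ E) (c : E) {r : ℝ} (hr : 0 < r) :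
    IsPreconnected (Metric.ball c r \ {c}) := by
  set f := OpenPartialHomeomorph.univBall c r with hf
  have himg : f '' {0}ᶜ = Metric.ball c r \ {c} := by
    have hinj : InjOn f univ := by
      simpa [hf] using f.injOn
    rw [compl_eq_univ_sdiff, hinj.image_sdiff_subset (subset_univ _)]
    have : f '' univ = Metric.ball c r := by
      have := f.image_source_eq_target
      rwa [hf, OpenPartialHomeomorph.univBall_source,
        OpenPartialHomeomorph.univBall_target c hr] at this
    rw [this, image_singleton, hf, OpenPartialHomeomorph.univBall_apply_zero]
  rw [← himg]
  exact (isConnected_compl_singleton_of_one_lt_rank h 0).isPreconnected.image _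
    (OpenPartialHomeomorph.continuous_univBall c r).continuousOn

/-- In a space locally modelled on a real inner product space of dimension at least two, an open set
with finite frontier has open closure. -/
theorem isOpen_closure_of_finite_frontier {E X : Type*} [NormedAddCommGroup E]
    [InnerProductSpace ℝ E] [TopologicalSpace X] [T1Space X] [ChartedSpace E X]
    (h : 1 < Module.rank ℝ E) {U : Set X} (hU : IsOpen U) (hfin : (frontier U).Finite) :
    IsOpen (closure U) := by
  rw [isOpen_iff_mem_nhds]
  intro x hx
  by_cases hxU : x ∈ U
  · exact mem_of_superset (hU.mem_nhds hxU) subset_closure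
  set φ := chartAt E x
  have hxs : x ∈ φ.source := mem_chart_source E x
  -- Removing the finitely many other frontier points leaves an open set in which `x` is the only
  -- possible frontier point.
  set W : Set X := φ.source \ (frontier U \ {x}) with hW
  have hWo : IsOpen W := φ.open_source.sdiff (hfin.subset sdiff_subset).isClosed
  have hxW : x ∈ W := ⟨hxs, fun h => h.2 rfl⟩
  have hWs : W ⊆ φ.source := sdiff_subset
  have hV : IsOpen (φ '' W) := φ.isOpen_image_of_subset_source hWo hWs
  obtain ⟨r, hr, hrV⟩ := Metric.isOpen_iff.1 hV (φ x) (mem_image_of_mem _ hxW)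
  set N : Set X := φ.symm '' (Metric.ball (φ x) r \ {φ x}) with hN
  have hball : Metric.ball (φ x) r ⊆ φ.target := by
    refine hrV.trans ?_
    rintro _ ⟨y, hy, rfl⟩
    exact φ.map_source (hWs hy)
  have hNconn : IsPreconnected N :=
    (isPreconnected_ball_diff_center h _ hr).image _
      (φ.continuousOn_symm.mono (sdiff_subset.trans hball))
  have hNW : ∀ y ∈ N, y ∈ W ∧ y ≠ x := by
    rintro _ ⟨z, ⟨hz, hzx⟩, rfl⟩
    obtain ⟨y, hy, rfl⟩ := hrV hz
    rw [φ.left_inv (hWs hy)]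
    exact ⟨hy, fun h => hzx (by rw [h]; rfl)⟩
  have hBopen : IsOpen (φ.symm '' Metric.ball (φ x) r) :=
    φ.symm.isOpen_image_of_subset_source Metric.isOpen_ball hball
  have hxB : x ∈ φ.symm '' Metric.ball (φ x) r :=
    ⟨φ x, Metric.mem_ball_self hr, φ.left_inv hxs⟩
  have hBN : ∀ y ∈ φ.symm '' Metric.ball (φ x) r, y = x ∨ y ∈ N := by
    rintro _ ⟨z, hz, rfl⟩
    by_cases hzx : z = φ x
    · left; rw [hzx, φ.left_inv hxs]
    · right; exact ⟨z, ⟨hz, hzx⟩, rfl⟩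
  have hNU : (N ∩ U).Nonempty := by
    obtain ⟨y, hyB, hyU⟩ := mem_closure_iff.1 hx _ hBopen hxB
    rcases hBN y hyB with rfl | hyN
    · exact absurd hyU hxU
    · exact ⟨y, hyN, hyU⟩
  -- The punctured disk `N` contains no frontier point, so by connectedness it lies on one side; it
  -- meets `U` because `x` is in the closure.
  have hsub : N ⊆ U ∪ (closure U)ᶜ := by
    intro y hy
    by_contra hcon
    simp only [mem_union, mem_compl_iff, not_or, not_not] at hcon
    have hfr : y ∈ frontier U := by
      rw [frontier, hU.interior_eq]; exact ⟨hcon.2, hcon.1⟩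
    exact (hNW y hy).1.2 ⟨hfr, (hNW y hy).2⟩
  have hNsub : N ⊆ U :=
    hNconn.subset_left_of_subset_union hU isClosed_closure.isOpen_compl
      (disjoint_compl_right.mono_left subset_closure) hsub hNU
  refine mem_of_superset (hBopen.mem_nhds hxB) fun y hy => ?_
  rcases hBN y hy with rfl | hyN
  · exact hx
  · exact subset_closure (hNsub hyN)

namespace CirclePattern

section Surface

variable {S : Type*} [TopologicalSpace S] [CWComplex (univ : Set S)]

/-- The frontier of an n-cell is covered by open cells of dimension below n ≤ m, and distinct open
cells are disjoint. -/
theorem disjoint_openCell_cellFrontier {n m : ℕ} (hnm : n ≤ m)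
    (j : RelCWComplex.cell (univ : Set S) n) (i : RelCWComplex.cell (univ : Set S) m) :
    Disjoint (RelCWComplex.openCell m i) (RelCWComplex.cellFrontier n j) := by
  obtain ⟨J, hJ⟩ := CWComplex.cellFrontier_subset_finite_openCell (C := (univ : Set S)) n j
  refine Disjoint.mono_right hJ ?_
  simp only [disjoint_iUnion_right]
  intro l hl q _
  refine RelCWComplex.disjoint_openCell_of_ne fun h => ?_
  have := congrArg Sigma.fst h
  simp only at this
  omega

/-- Open cells of top dimension are open. -/
theorem isOpen_openCell_of_top [T2Space S] {m : ℕ}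
    (hdim : ∀ n, m < n → IsEmpty (RelCWComplex.cell (univ : Set S) n))
    (i : RelCWComplex.cell (univ : Set S) m) : IsOpen (RelCWComplex.openCell m i) := by
  rw [← isClosed_compl_iff]
  -- Closedness of the complement is tested cell by cell: it misses the open cell `i` itself and
  -- contains every other closed cell.
  refine CWComplex.isClosed_of_disjoint_openCell_or_isClosed_inter_closedCell
    (C := (univ : Set S)) (subset_univ _) fun n _ j => ?_
  have hnm : n ≤ m := by
    by_contra! h
    exact (hdim n h).false j
  by_cases hij : (⟨m, i⟩ : Σ n, RelCWComplex.cell (univ : Set S) n) = ⟨n, j⟩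
  · left
    obtain ⟨rfl, h⟩ := Sigma.mk.inj_iff.1 hij
    rw [heq_eq_eq] at h
    subst h
    exact disjoint_compl_left
  · right
    rw [inter_eq_right.2]
    · exact RelCWComplex.isClosed_closedCell
    · rw [← RelCWComplex.cellFrontier_union_openCell_eq_closedCell, subset_compl_iff_disjoint_left]
      exact (disjoint_openCell_cellFrontier hnm j i).union_right
        (RelCWComplex.disjoint_openCell_of_ne hij)

/-- On a connected surface with at least two faces, every face has an edge. -/
theorem exists_edge_of_face [T2Space S] [ConnectedSpace S]
    [ChartedSpace (EuclideanSpace ℝ (Fin 2)) S]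
    [Finite (RelCWComplex.cell (univ : Set S) 0)]
    (hdim : ∀ n, 2 < n → IsEmpty (RelCWComplex.cell (univ : Set S) n))
    {f₁ f₂ : Edges S → Faces S} (hsides : ∀ e, LieOnTwoSides e (f₁ e) (f₂ e))
    {i j : Faces S} (hij : i ≠ j) : ∃ e, f₁ e = i ∨ f₂ e = i := by
  by_contra! hno
  have hU := isOpen_openCell_of_top hdim i
  have hdisj : ∀ l, l ≠ i → Disjoint (RelCWComplex.openCell 2 i) (RelCWComplex.openCell 2 l) :=
    fun l hl => RelCWComplex.disjoint_openCell_of_ne fun h => hl (by simpa using h.symm)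
  -- An edge that does not border `i` has a neighbourhood consisting of itself and parts of other
  -- faces, and other faces are open; only vertices can remain in the frontier.
  have hfront : frontier (RelCWComplex.openCell 2 i) ⊆
      ⋃ v : RelCWComplex.cell (univ : Set S) 0, RelCWComplex.openCell 0 v := by
    intro x hx
    obtain ⟨n, q, hxq⟩ : ∃ n, ∃ q : RelCWComplex.cell (univ : Set S) n,
        x ∈ RelCWComplex.openCell n q := by
      have := mem_univ x
      rw [← CWComplex.iUnion_openCell_eq_complex (C := (univ : Set S))] at this
      simpa using this
    rw [frontier, hU.interior_eq] at hx
    have key : ∀ V : Set S, IsOpen V → x ∈ V →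
        ¬ Disjoint (RelCWComplex.openCell 2 i) V := fun V hV hxV hd => by
      obtain ⟨y, hy, hy'⟩ := mem_closure_iff.1 hx.1 V hV hxV
      exact disjoint_left.1 hd hy' hy
    rcases Nat.lt_or_ge 2 n with hn | hn
    · exact ((hdim n hn).false q).elim
    interval_cases n
    · exact mem_iUnion.2 ⟨q, hxq⟩
    · exfalso
      obtain ⟨ψ, hψ, h0, h1, h2⟩ := hsides q
      refine key (range ψ) hψ.isOpen_range ?_ ?_
      · rw [← h0] at hxq
        exact image_subset_range _ _ hxq
      · rw [disjoint_right]
        rintro _ ⟨z, rfl⟩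
        rcases lt_trichotomy z.2 0 with hz | hz | hz
        · exact fun hi => disjoint_left.1 (hdisj _ (hno q).2) hi (h2 ⟨z, hz, rfl⟩)
        · intro hi
          have : ψ z ∈ RelCWComplex.openCell 1 q := by
            rw [← h0]; exact ⟨z, hz, rfl⟩
          refine disjoint_left.1 (RelCWComplex.disjoint_openCell_of_ne fun h => ?_) hi this
          simpa using congrArg Sigma.fst h
        · exact fun hi => disjoint_left.1 (hdisj _ (hno q).1) hi (h1 ⟨z, hz, rfl⟩)
    · exfalso
      by_cases hqi : q = i
      · exact hx.2 (hqi ▸ hxq)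
      · exact key _ (isOpen_openCell_of_top hdim q) hxq (hdisj q hqi)
  have hfin : (frontier (RelCWComplex.openCell 2 i)).Finite := by
    refine (finite_iUnion fun v => ?_).subset hfront
    rw [RelCWComplex.openCell_zero_eq_singleton]
    exact finite_singleton _
  have hrank : 1 < Module.rank ℝ (EuclideanSpace ℝ (Fin 2)) := by
    rw [← Module.finrank_eq_rank]; simp
  have hclopen : IsClopen (closure (RelCWComplex.openCell 2 i)) :=
    ⟨isClosed_closure, isOpen_closure_of_finite_frontier hrank hU hfin⟩
  have huniv := hclopen.eq_univ (RelCWComplex.openCell_nonempty 2 i).closure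
  have hd := (hdisj j hij.symm).closure_left (isOpen_openCell_of_top hdim j)
  rw [huniv] at hd
  obtain ⟨y, hy⟩ := RelCWComplex.openCell_nonempty 2 j
  exact disjoint_left.1 hd (mem_univ y) hy

end Surface

end CirclePattern

namespace CirclePattern

/-! ### A closed formula for the curvature of a bigon side -/

/-- The inverse cotangent with values in `(0, π)`. -/
noncomputable def arccot (x : ℝ) : ℝ := Real.pi / 2 - Real.arctan x

/-- The closed formula for `sideCurvature` at nonnegative curvatures. -/
noncomputable def sideFormula (φ k k' : ℝ) : ℝ :=
  2 * (k / √(1 + k ^ 2)) * arccot ((k * Real.cos φ + k') / (√(1 + k ^ 2) * Real.sin φ))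

theorem norm_fromPole (α r : ℝ) : ‖fromPole α r‖ = 1 := by
  rw [EuclideanSpace.norm_eq, Real.sqrt_eq_one]
  simp only [fromPole, Fin.sum_univ_three, Real.norm_eq_abs, sq_abs]
  simp
  linear_combination Real.sin_sq_add_cos_sq r + Real.sin r ^ 2 * Real.sin_sq_add_cos_sq α

theorem boundaryCircle_eq (r θ : ℝ) : boundaryCircle r θ =
    !₂[Real.cos r * Real.sin r * (1 - Real.cos θ), Real.sin r * Real.sin θ,
      Real.cos r ^ 2 + Real.sin r ^ 2 * Real.cos θ] := by
  ext j
  fin_cases j <;> simp [boundaryCircle, fromPole] <;> ring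

theorem norm_boundaryCircle (r θ : ℝ) : ‖boundaryCircle r θ‖ = 1 := by
  rw [EuclideanSpace.norm_eq, Real.sqrt_eq_one, boundaryCircle_eq]
  simp only [Fin.sum_univ_three, Real.norm_eq_abs, sq_abs]
  simp
  have h1 := Real.sin_sq_add_cos_sq r
  have h2 := Real.sin_sq_add_cos_sq θ
  rw [← eq_sub_iff_add_eq] at h1 h2
  ring_nf
  rw [show Real.sin r ^ 4 = (Real.sin r ^ 2) ^ 2 by ring, h2, h1]
  ring

theorem norm_deriv_boundaryCircle {r : ℝ} (hr : 0 ≤ Real.sin r) (θ : ℝ) :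
    ‖deriv (boundaryCircle r) θ‖ = Real.sin r := by
  have h : HasDerivAt (boundaryCircle r)
      (Real.sin r • (-Real.sin θ • !₂[-Real.cos r, 0, Real.sin r] +
        Real.cos θ • !₂[0, 1, 0]) : EuclideanSpace ℝ (Fin 3)) θ := by
    unfold boundaryCircle
    refine HasDerivAt.const_add _ (HasDerivAt.const_smul (Real.sin r) ?_)
    exact ((Real.hasDerivAt_cos θ).smul_const _).add ((Real.hasDerivAt_sin θ).smul_const _)
  rw [h.deriv, norm_smul, Real.norm_of_nonneg hr]
  have : ‖(-Real.sin θ • !₂[-Real.cos r, 0, Real.sin r] +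
      Real.cos θ • !₂[0, 1, 0] : EuclideanSpace ℝ (Fin 3))‖ = 1 := by
    rw [EuclideanSpace.norm_eq, Real.sqrt_eq_one]
    simp only [Fin.sum_univ_three, Real.norm_eq_abs, sq_abs]
    simp
    linear_combination Real.sin_sq_add_cos_sq θ + Real.sin θ ^ 2 * Real.sin_sq_add_cos_sq r
  rw [this, mul_one]

theorem mem_sphericalDisk_iff {c x : EuclideanSpace ℝ (Fin 3)} (hc : ‖c‖ = 1) (hx : ‖x‖ = 1)
    {r : ℝ} (h0 : 0 ≤ r) (hπ : r ≤ Real.pi) :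
    x ∈ sphericalDisk c r ↔ Real.cos r < inner ℝ c x := by
  have hle : |inner ℝ c x| ≤ 1 := by simpa [hc, hx] using abs_real_inner_le_norm c x
  simp only [sphericalDisk, mem_ofPred_eq, hx, true_and, InnerProductGeometry.angle, hc, mul_one,
    div_one]
  rw [← Real.strictAntiOn_cos.lt_iff_gt ⟨h0, hπ⟩ ⟨Real.arccos_nonneg _, Real.arccos_le_pi _⟩,
    Real.cos_arccos (abs_le.1 hle).1 (abs_le.1 hle).2]

theorem inner_fromPole_boundaryCircle (φ r r' θ : ℝ) :
    inner ℝ (fromPole (Real.pi - φ) r') (boundaryCircle r θ) =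
      -(Real.cos r * Real.sin r * (1 - Real.cos θ)) * (Real.sin r' * Real.cos φ) +
        Real.sin r * Real.sin θ * (Real.sin r' * Real.sin φ) +
        (1 - Real.sin r ^ 2 * (1 - Real.cos θ)) * Real.cos r' := by
  rw [boundaryCircle_eq, PiLp.inner_apply]
  simp only [fromPole, Fin.sum_univ_three]
  simp
  left
  linear_combination Real.sin_sq_add_cos_sq r

/-- With θ = 2x the difference of the two sides is 2 sin x (a cos x - b sin x). It is nonpositive
for x ≤ 0; for x > 0 its sign compares cot x with b / a. -/
theorem mul_one_sub_cos_lt_iff {a b θ : ℝ} (ha : 0 < a) (hb : 0 ≤ b)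
    (hθ : θ ∈ Ioc (-Real.pi) Real.pi) :
    b * (1 - Real.cos θ) < a * Real.sin θ ↔ θ ∈ Ioo 0 (2 * arccot (b / a)) := by
  obtain ⟨x, rfl⟩ : ∃ x, θ = 2 * x := ⟨θ / 2, by ring⟩
  have hx1 : -(Real.pi / 2) < x := by linarith [hθ.1]
  have hx2 : x ≤ Real.pi / 2 := by linarith [hθ.2]
  have hcos : 0 ≤ Real.cos x := Real.cos_nonneg_of_neg_pi_div_two_le_of_le hx1.le hx2
  have hrw : b * (1 - Real.cos (2 * x)) < a * Real.sin (2 * x) ↔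
      0 < Real.sin x * (a * Real.cos x - b * Real.sin x) := by
    rw [Real.cos_two_mul, Real.sin_two_mul, Real.cos_sq']
    constructor <;> intro h <;> nlinarith
  rw [hrw]
  rcases le_or_gt x 0 with hx | hx
  · have hs : Real.sin x ≤ 0 := Real.sin_nonpos_of_nonpos_of_neg_pi_le hx (by linarith)
    refine iff_of_false (not_lt.2 ?_) fun h => by linarith [h.1]
    nlinarith [mul_nonneg ha.le hcos, mul_nonneg hb (sq_nonneg (Real.sin x)),
      mul_nonneg (mul_nonneg ha.le hcos) (neg_nonneg.2 hs)]
  · have hs : 0 < Real.sin x := Real.sin_pos_of_pos_of_lt_pi hx (by linarith [Real.pi_pos])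
    rw [mul_pos_iff_of_pos_left hs, sub_pos, mem_Ioo, and_iff_right (by linarith)]
    have h1 : 2 * x < 2 * arccot (b / a) ↔ Real.arctan (b / a) < Real.pi / 2 - x := by
      unfold arccot; constructor <;> intro h <;> linarith
    rw [h1, ← Real.arctan_tan (x := Real.pi / 2 - x) (by linarith) (by linarith),
      Real.arctan_strictMono.lt_iff_lt, Real.tan_pi_div_two_sub, Real.tan_eq_sin_div_cos, inv_div,
      div_lt_div_iff₀ ha hs, mul_comm a]

theorem arccot_le_pi_div_two {x : ℝ} (hx : 0 ≤ x) : arccot x ≤ Real.pi / 2 := by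
  have := Real.arctan_nonneg.2 hx
  unfold arccot; linarith

theorem arccot_pos (x : ℝ) : 0 < arccot x := by
  have := Real.arctan_lt_pi_div_two x
  unfold arccot; linarith

/-- Divided by sin r sin r', the condition to lie in the second disk becomes that of
`mul_one_sub_cos_lt_iff` with a = sin φ. The side is therefore a single arc, traversed at constant
speed sin r. -/
theorem bigonSideLength_eq {φ r r' : ℝ} (hφ : φ ∈ Ioo 0 (Real.pi / 2))
    (hr : r ∈ Ioc 0 (Real.pi / 2)) (hr' : r' ∈ Ioc 0 (Real.pi / 2)) :
    bigonSideLength φ r r' = 2 * Real.sin r *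
      arccot ((Real.cos r * Real.cos φ + Real.sin r * Real.cot r') / Real.sin φ) := by
  have hπ := Real.pi_pos
  have hsφ : 0 < Real.sin φ := Real.sin_pos_of_pos_of_lt_pi hφ.1 (by linarith [hφ.2])
  have hsr : 0 < Real.sin r := Real.sin_pos_of_pos_of_lt_pi hr.1 (by linarith [hr.2])
  have hsr' : 0 < Real.sin r' := Real.sin_pos_of_pos_of_lt_pi hr'.1 (by linarith [hr'.2])
  have hcφ : 0 ≤ Real.cos φ :=
    Real.cos_nonneg_of_neg_pi_div_two_le_of_le (by linarith [hφ.1]) hφ.2.le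
  have hcr : 0 ≤ Real.cos r :=
    Real.cos_nonneg_of_neg_pi_div_two_le_of_le (by linarith [hr.1]) hr.2
  have hcr' : 0 ≤ Real.cos r' :=
    Real.cos_nonneg_of_neg_pi_div_two_le_of_le (by linarith [hr'.1]) hr'.2
  set b := Real.cos r * Real.cos φ + Real.sin r * Real.cot r' with hb
  have hb0 : 0 ≤ b := by
    rw [hb, Real.cot_eq_cos_div_sin]; positivity
  have hset : {θ | θ ∈ Ioc (-Real.pi) Real.pi ∧
      boundaryCircle r θ ∈ sphericalDisk (fromPole (Real.pi - φ) r') r'} =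
      Ioo 0 (2 * arccot (b / Real.sin φ)) := by
    have key : ∀ θ, boundaryCircle r θ ∈ sphericalDisk (fromPole (Real.pi - φ) r') r' ↔
        b * (1 - Real.cos θ) < Real.sin φ * Real.sin θ := fun θ => by
      rw [mem_sphericalDisk_iff (norm_fromPole _ _) (norm_boundaryCircle _ _) hr'.1.le
        (by linarith [hr'.2]), inner_fromPole_boundaryCircle, ← sub_pos,
        ← sub_pos (b := b * _), ← mul_pos_iff_of_pos_left (a := Real.sin r * Real.sin r')
          (b := _ - b * _) (by positivity)]
      refine iff_of_eq (congrArg _ ?_)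
      rw [hb, Real.cot_eq_cos_div_sin]
      field_simp
      ring
    ext θ
    rw [mem_ofPred_eq, key]
    constructor
    · rintro ⟨hθ, h⟩
      exact (mul_one_sub_cos_lt_iff hsφ hb0 hθ).1 h
    · intro h
      have hθ : θ ∈ Ioc (-Real.pi) Real.pi := by
        have := arccot_le_pi_div_two (x := b / Real.sin φ) (by positivity)
        exact ⟨by linarith [h.1], by linarith [h.2]⟩
      exact ⟨hθ, (mul_one_sub_cos_lt_iff hsφ hb0 hθ).2 h⟩
  unfold bigonSideLength
  rw [hset]
  simp_rw [norm_deriv_boundaryCircle hsr.le]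
  have := arccot_pos (b / Real.sin φ)
  rw [setIntegral_const, smul_eq_mul, measureReal_def, Real.volume_Ioo,
    ENNReal.toReal_ofReal (by linarith)]
  ring

theorem sideCurvature_eq {φ k k' : ℝ} (hφ : φ ∈ Ioo 0 (Real.pi / 2)) (hk : 0 ≤ k) (hk' : 0 ≤ k') :
    sideCurvature φ k k' = sideFormula φ k k' := by
  have hmem : ∀ {x : ℝ}, 0 ≤ x → radius x ∈ Ioc 0 (Real.pi / 2) := fun {x} hx => by
    have h1 := Real.arctan_lt_pi_div_two x
    have h2 := Real.arctan_nonneg.2 hx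
    unfold radius
    exact ⟨by linarith, by linarith⟩
  have hs : 0 < √(1 + k ^ 2) := by positivity
  have hcot : Real.cot (radius k') = k' := by
    rw [← Real.tan_inv_eq_cot, radius, Real.tan_pi_div_two_sub, inv_inv, Real.tan_arctan]
  rw [sideCurvature, bigonSideLength_eq hφ (hmem hk) (hmem hk'), hcot, sideFormula, radius,
    Real.sin_pi_div_two_sub, Real.cos_pi_div_two_sub, Real.cos_arctan, Real.sin_arctan]
  rw [show (k / √(1 + k ^ 2) * Real.cos φ + 1 / √(1 + k ^ 2) * k') / Real.sin φ =
    (k * Real.cos φ + k') / (√(1 + k ^ 2) * Real.sin φ) by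
      rw [← div_div]; congr 1; field_simp]
  ring

end CirclePattern

namespace CirclePattern

/-! ### Monotonicity, limits and Lipschitz bounds for the curvature of a bigon side -/

theorem continuous_arccot : Continuous arccot := by
  unfold arccot; exact continuous_const.sub Real.continuous_arctan

theorem arccot_strictAnti : StrictAnti arccot := fun x y h => by
  have := Real.arctan_strictMono h
  unfold arccot; linarith

theorem arccot_eq_of_cos_eq {x β : ℝ} (hβ : β ∈ Ioo 0 Real.pi)
    (h : Real.cos β = x * Real.sin β) : arccot x = β := by
  have hs := Real.sin_pos_of_mem_Ioo hβ
  have hx : x = Real.tan (Real.pi / 2 - β) := by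
    rw [Real.tan_pi_div_two_sub, Real.tan_eq_sin_div_cos, inv_div, h]
    field_simp
  rw [arccot, hx, Real.arctan_tan (by linarith [hβ.2]) (by linarith [hβ.1])]
  ring

theorem cos_arccot (x : ℝ) : Real.cos (arccot x) = x * Real.sin (arccot x) := by
  rw [arccot, Real.cos_pi_div_two_sub, Real.sin_pi_div_two_sub, Real.sin_arctan, Real.cos_arctan]
  ring

/-- This is sin u < u at u = 2 arccot x. It is exactly the positivity of the derivative of x arccot
x. -/
theorem div_one_add_sq_lt_arccot (x : ℝ) : x / (1 + x ^ 2) < arccot x := by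
  have hpos := arccot_pos x
  have h := Real.sin_lt (x := 2 * arccot x) (by linarith)
  rw [Real.sin_two_mul, cos_arccot, arccot, Real.sin_pi_div_two_sub, Real.cos_arctan] at h
  have hsq : √(1 + x ^ 2) ^ 2 = 1 + x ^ 2 := Real.sq_sqrt (by positivity)
  have : 2 * (1 / √(1 + x ^ 2)) * (x * (1 / √(1 + x ^ 2))) = 2 * (x / (1 + x ^ 2)) := by
    rw [show 2 * (1 / √(1 + x ^ 2)) * (x * (1 / √(1 + x ^ 2))) = 2 * (x / √(1 + x ^ 2) ^ 2) by
      field_simp, hsq]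
  rw [this] at h
  unfold arccot; linarith

theorem strictMono_mul_arccot : StrictMono fun x => x * arccot x := by
  have hd : ∀ x, HasDerivAt (fun x => x * arccot x) (1 * arccot x + x * -(1 / (1 + x ^ 2))) x :=
    fun x => (hasDerivAt_id x).mul ((Real.hasDerivAt_arctan x).const_sub _)
  refine strictMono_of_deriv_pos fun x => ?_
  rw [(hd x).deriv]
  have := div_one_add_sq_lt_arccot x
  rw [mul_neg, mul_one_div]
  linarith

/-- The Euclidean angle sum: for large curvatures the two sides of a bigon of angle `φ` have
half-curvatures adding up to `φ`. -/
theorem arccot_add_arccot {φ k k' : ℝ} (hφ : φ ∈ Ioo 0 (Real.pi / 2)) (hk : 0 < k) (hk' : 0 < k') :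
    arccot ((k * Real.cos φ + k') / (k * Real.sin φ)) +
      arccot ((k' * Real.cos φ + k) / (k' * Real.sin φ)) = φ := by
  have hφπ : φ ∈ Ioo 0 Real.pi := ⟨hφ.1, by linarith [hφ.2, Real.pi_pos]⟩
  have hs := Real.sin_pos_of_mem_Ioo hφπ
  set x := (k * Real.cos φ + k') / (k * Real.sin φ) with hx
  -- This places φ - arccot x in (0, π), where the relation between cosine and sine determines the
  -- arccotangent.
  have hlt : arccot x < φ := by
    rw [← arccot_eq_of_cos_eq (x := Real.cos φ / Real.sin φ) hφπ (by field_simp)]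
    apply arccot_strictAnti
    rw [hx, div_lt_div_iff₀ hs (by positivity)]
    nlinarith [mul_pos hk' hs]
  have hpos := arccot_pos x
  have h2 : arccot ((k' * Real.cos φ + k) / (k' * Real.sin φ)) = φ - arccot x := by
    refine arccot_eq_of_cos_eq ⟨by linarith, by linarith [hφπ.2]⟩ ?_
    rw [Real.cos_sub, Real.sin_sub, cos_arccot]
    generalize Real.sin (arccot x) = y
    rw [hx]
    field_simp
    linear_combination y * k * k' * Real.sin_sq_add_cos_sq φ
  rw [h2]; ring

theorem div_sqrt_one_add_sq_strictMono : StrictMono fun x : ℝ => x / √(1 + x ^ 2) := by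
  intro x y h
  simp only [← Real.sin_arctan]
  exact Real.strictMonoOn_sin ⟨(Real.neg_pi_div_two_lt_arctan x).le,
    (Real.arctan_lt_pi_div_two x).le⟩ ⟨(Real.neg_pi_div_two_lt_arctan y).le,
    (Real.arctan_lt_pi_div_two y).le⟩ (Real.arctan_strictMono h)

theorem div_sqrt_one_add_sq_le_one (x : ℝ) : x / √(1 + x ^ 2) ≤ 1 := by
  rw [← Real.sin_arctan]; exact Real.sin_le_one _

theorem tendsto_div_sqrt_one_add_sq :
    Tendsto (fun x : ℝ => x / √(1 + x ^ 2)) atTop (𝓝 1) := by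
  simp only [← Real.sin_arctan]
  have := (Real.continuous_sin.tendsto (Real.pi / 2)).comp
    (Real.tendsto_arctan_atTop.mono_right nhdsWithin_le_nhds)
  rwa [Real.sin_pi_div_two] at this

section

variable {φ : ℝ}

theorem sideFormula_zero (φ k' : ℝ) : sideFormula φ 0 k' = 0 := by simp [sideFormula]

theorem sideFormula_pos {k : ℝ} (hk : 0 < k) (k' : ℝ) : 0 < sideFormula φ k k' := by
  have := arccot_pos ((k * Real.cos φ + k') / (√(1 + k ^ 2) * Real.sin φ))
  unfold sideFormula
  positivity

theorem sin_pos_of_mem (hφ : φ ∈ Ioo 0 (Real.pi / 2)) : 0 < Real.sin φ :=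
  Real.sin_pos_of_pos_of_lt_pi hφ.1 (by linarith [hφ.2, Real.pi_pos])

theorem cos_pos_of_mem (hφ : φ ∈ Ioo 0 (Real.pi / 2)) : 0 < Real.cos φ :=
  Real.cos_pos_of_mem_Ioo ⟨by linarith [hφ.1, Real.pi_pos], hφ.2⟩

theorem sideFormula_antitone (hφ : φ ∈ Ioo 0 (Real.pi / 2)) {k : ℝ} (hk : 0 ≤ k) :
    Antitone (sideFormula φ k) := fun a b hab => by
  have hs := sin_pos_of_mem hφ
  unfold sideFormula
  refine mul_le_mul_of_nonneg_left (arccot_strictAnti.antitone ?_) (by positivity)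
  gcongr

theorem sideFormula_nonneg {k : ℝ} (hk : 0 ≤ k) (k' : ℝ) : 0 ≤ sideFormula φ k k' := by
  rcases hk.eq_or_lt with rfl | hk
  · rw [sideFormula_zero]
  · exact (sideFormula_pos hk k').le

theorem sideFormula_le_pi_mul (hφ : φ ∈ Ioo 0 (Real.pi / 2)) {k k' : ℝ} (hk : 0 ≤ k)
    (hk' : 0 ≤ k') : sideFormula φ k k' ≤ Real.pi * (k / √(1 + k ^ 2)) := by
  have hs := sin_pos_of_mem hφ
  have hc := cos_pos_of_mem hφ
  have h := arccot_le_pi_div_two (x := (k * Real.cos φ + k') / (√(1 + k ^ 2) * Real.sin φ))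
    (by positivity)
  unfold sideFormula
  have := mul_le_mul_of_nonneg_left h (a := k / √(1 + k ^ 2)) (by positivity)
  linarith

theorem continuous_sideFormula (hφ : φ ∈ Ioo 0 (Real.pi / 2)) :
    Continuous fun p : ℝ × ℝ => sideFormula φ p.1 p.2 := by
  have hs := (sin_pos_of_mem hφ).ne'
  have hq : ∀ p : ℝ × ℝ, √(1 + p.1 ^ 2) ≠ 0 := fun p => by positivity
  unfold sideFormula
  refine Continuous.mul (by fun_prop (disch := assumption)) (continuous_arccot.comp ?_)
  refine Continuous.div (by fun_prop) (by fun_prop) fun p => mul_ne_zero (hq p) hs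

/-- The last quotient depends only on k' / k, so a common scaling acts only through k / √(1 + k²).
-/
theorem sideFormula_eq {k : ℝ} (hk : 0 < k) (k' : ℝ) :
    sideFormula φ k k' = 2 * (k / √(1 + k ^ 2)) *
      arccot (k / √(1 + k ^ 2) * ((k * Real.cos φ + k') / (k * Real.sin φ))) := by
  unfold sideFormula
  congr 2
  rw [div_mul_div_comm, mul_comm (√_) (k * _), mul_assoc k, mul_div_mul_left _ _ hk.ne', mul_comm (√_)]

/-- The curvature of a bigon side strictly increases when both curvatures are scaled up. -/
theorem sideFormula_lt_scale (hφ : φ ∈ Ioo 0 (Real.pi / 2)) {k k' c : ℝ} (hk : 0 < k)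
    (hk' : 0 ≤ k') (hc : 1 < c) : sideFormula φ k k' < sideFormula φ (c * k) (c * k') := by
  have hs := sin_pos_of_mem hφ
  have hcos := cos_pos_of_mem hφ
  have hc0 : 0 < c := by linarith
  rw [sideFormula_eq hk, sideFormula_eq (mul_pos hc0 hk)]
  have hY : (c * k * Real.cos φ + c * k') / (c * k * Real.sin φ) =
      (k * Real.cos φ + k') / (k * Real.sin φ) := by
    rw [mul_assoc, mul_assoc, ← mul_add, mul_div_mul_left _ _ hc0.ne']
  rw [hY]
  set Y := (k * Real.cos φ + k') / (k * Real.sin φ)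
  have hYpos : 0 < Y := by positivity
  have hlt : k / √(1 + k ^ 2) < c * k / √(1 + (c * k) ^ 2) :=
    div_sqrt_one_add_sq_strictMono (by nlinarith)
  -- Multiplied by the scale-invariant `Y`, both curvatures take the form 2 x arccot x.
  have := strictMono_mul_arccot (mul_lt_mul_of_pos_right hlt hYpos)
  simp only at this
  rw [← mul_lt_mul_iff_left₀ hYpos]
  linarith

/-- The factor k / √(1 + k²) is at least its value at R, and inside the decreasing arccot it may be
replaced by 1. What remains is the Euclidean angle of `arccot_add_arccot`. -/
theorem sideFormula_lower_bound (hφ : φ ∈ Ioo 0 (Real.pi / 2)) {R k k' : ℝ} (hR : 0 < R)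
    (hRk : R ≤ k) (hk' : 0 ≤ k') :
    2 * (R / √(1 + R ^ 2)) * arccot ((k * Real.cos φ + k') / (k * Real.sin φ)) ≤
      sideFormula φ k k' := by
  have hs := sin_pos_of_mem hφ
  have hcos := cos_pos_of_mem hφ
  have hk : 0 < k := hR.trans_le hRk
  rw [sideFormula_eq hk]
  set Y := (k * Real.cos φ + k') / (k * Real.sin φ)
  have hYpos : 0 < Y := by positivity
  have h1 : R / √(1 + R ^ 2) ≤ k / √(1 + k ^ 2) := div_sqrt_one_add_sq_strictMono.monotone hRk
  have h2 : arccot Y ≤ arccot (k / √(1 + k ^ 2) * Y) := arccot_strictAnti.antitone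
    (mul_le_of_le_one_left hYpos.le (div_sqrt_one_add_sq_le_one k))
  have := (arccot_pos Y).le
  gcongr

theorem sideFormula_add_lower_bound (hφ : φ ∈ Ioo 0 (Real.pi / 2)) {R k k' : ℝ} (hR : 0 < R)
    (hk : R ≤ k) (hk' : R ≤ k') :
    2 * (R / √(1 + R ^ 2)) * φ ≤ sideFormula φ k k' + sideFormula φ k' k := by
  have h1 := sideFormula_lower_bound hφ hR hk (hR.le.trans hk')
  have h2 := sideFormula_lower_bound hφ hR hk' (hR.le.trans hk)
  have h3 := arccot_add_arccot hφ (hR.trans_le hk) (hR.trans_le hk')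
  calc _ = 2 * (R / √(1 + R ^ 2)) * arccot ((k * Real.cos φ + k') / (k * Real.sin φ)) +
        2 * (R / √(1 + R ^ 2)) * arccot ((k' * Real.cos φ + k) / (k' * Real.sin φ)) := by
        rw [← mul_add, h3]
    _ ≤ _ := add_le_add h1 h2

theorem sideFormula_lower_bound_of_le (hφ : φ ∈ Ioo 0 (Real.pi / 2)) {R C k k' : ℝ} (hR : 0 < R)
    (hRk : R ≤ k) (hk' : 0 ≤ k') (hC : k' ≤ C) :
    2 * (R / √(1 + R ^ 2)) * arccot ((Real.cos φ + C / R) / Real.sin φ) ≤ sideFormula φ k k' := by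
  refine le_trans ?_ (sideFormula_lower_bound hφ hR hRk hk')
  have hs := sin_pos_of_mem hφ
  have hk : 0 < k := hR.trans_le hRk
  refine mul_le_mul_of_nonneg_left (arccot_strictAnti.antitone ?_) (by positivity)
  rw [← div_div, add_div, mul_div_cancel_left₀ _ hk.ne']
  gcongr
  exact hk'.trans hC

/-- The argument tends to cot φ. In the limit the bound for an edge with one side in A is thus 2φ,
the same as for an edge with both sides in A, which is why E_A counts each edge once. -/
theorem tendsto_sideFormula_lower_bound (hφ : φ ∈ Ioo 0 (Real.pi / 2)) (C : ℝ) :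
    Tendsto (fun R : ℝ => 2 * (R / √(1 + R ^ 2)) * arccot ((Real.cos φ + C / R) / Real.sin φ))
      atTop (𝓝 (2 * φ)) := by
  have hφπ : φ ∈ Ioo 0 Real.pi := ⟨hφ.1, by linarith [hφ.2, Real.pi_pos]⟩
  have hs := sin_pos_of_mem hφ
  have h1 : Tendsto (fun R : ℝ => (Real.cos φ + C / R) / Real.sin φ) atTop
      (𝓝 (Real.cos φ / Real.sin φ)) := by
    have := ((tendsto_const_nhds (x := C)).div_atTop tendsto_id).const_add (Real.cos φ)
    simpa using this.div_const (Real.sin φ)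
  have h2 := (continuous_arccot.tendsto _).comp h1
  rw [arccot_eq_of_cos_eq (x := Real.cos φ / Real.sin φ) hφπ (by field_simp)] at h2
  simpa using (tendsto_div_sqrt_one_add_sq.const_mul 2).mul h2

theorem abs_sub_le_of_deriv_mem_Icc {f f' : ℝ → ℝ} (hf : ∀ x, HasDerivAt f (f' x) x)
    (hf' : ∀ x, f' x ∈ Icc 0 1) (x y : ℝ) : |f x - f y| ≤ |x - y| := by
  have := convex_univ.norm_image_sub_le_of_norm_hasDerivWithin_le (f := f) (f' := f') (C := 1)
    (x := y) (y := x) (fun z _ => (hf z).hasDerivWithinAt)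
    (fun z _ => by rw [Real.norm_of_nonneg (hf' z).1]; exact (hf' z).2) (mem_univ _) (mem_univ _)
  simpa using this

theorem abs_arctan_exp_sub_le (x y : ℝ) :
    |Real.arctan (Real.exp x) - Real.arctan (Real.exp y)| ≤ |x - y| := by
  refine abs_sub_le_of_deriv_mem_Icc (f := fun x => Real.arctan (Real.exp x))
    (fun x => (Real.hasDerivAt_exp x).arctan) (fun x => ?_) x y
  have := Real.exp_pos x
  refine ⟨by positivity, ?_⟩
  rw [one_div, ← div_eq_inv_mul, div_le_one (by positivity)]
  nlinarith [sq_nonneg (Real.exp x - 1)]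

theorem abs_log_add_exp_sub_le {a : ℝ} (ha : 0 ≤ a) (x y : ℝ) :
    |Real.log (a + Real.exp x) - Real.log (a + Real.exp y)| ≤ |x - y| := by
  refine abs_sub_le_of_deriv_mem_Icc (f := fun x => Real.log (a + Real.exp x))
    (fun x => ((Real.hasDerivAt_exp x).const_add a).log (by positivity)) (fun x => ?_) x y
  refine ⟨by positivity, ?_⟩
  rw [div_le_one (by positivity)]
  linarith

/-- In logarithmic coordinates the curvature of a bigon side is globally Lipschitz. -/
theorem abs_sideFormula_exp_sub_le (hφ : φ ∈ Ioo 0 (Real.pi / 2)) {s s' t t' d : ℝ}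
    (hd : |s - t| ≤ d) (hd' : |s' - t'| ≤ d) :
    |sideFormula φ (Real.exp s) (Real.exp s') - sideFormula φ (Real.exp t) (Real.exp t')| ≤
      12 * d := by
  have hsin := sin_pos_of_mem hφ
  have hcos := cos_pos_of_mem hφ
  -- The logarithm of the argument of arccot, with exp s pulled out of the numerator so that every
  -- term is Lipschitz.
  set u : ℝ → ℝ → ℝ := fun s s' => s + Real.log (Real.cos φ + Real.exp (s' - s)) -
    Real.log (1 + Real.exp (2 * s)) / 2 - Real.log (Real.sin φ) with hu
  have harg : ∀ s s', (Real.exp s * Real.cos φ + Real.exp s') /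
      (√(1 + Real.exp s ^ 2) * Real.sin φ) = Real.exp (u s s') := fun s s' => by
    have h2 : Real.exp s ^ 2 = Real.exp (2 * s) := by rw [← Real.exp_nat_mul]; norm_num
    rw [hu]
    simp only
    rw [Real.exp_sub, Real.exp_sub, Real.exp_add, Real.exp_log (by positivity),
      Real.exp_log hsin, Real.exp_half, Real.exp_log (by positivity), h2, div_div, mul_add,
      ← Real.exp_add]
    congr 3
    ring
  have hform : ∀ s s', sideFormula φ (Real.exp s) (Real.exp s') =
      2 * (Real.sin (Real.arctan (Real.exp s)) * arccot (Real.exp (u s s'))) := fun s s' => by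
    rw [sideFormula, harg, Real.sin_arctan]; ring
  -- The three varying terms change by at most d, 2d and 2d / 2.
  have hdu : |u s s' - u t t'| ≤ 4 * d := by
    have h1 := abs_log_add_exp_sub_le hcos.le (s' - s) (t' - t)
    have h2 := abs_log_add_exp_sub_le zero_le_one (2 * s) (2 * t)
    rw [abs_le] at *
    have h3 : |s' - s - (t' - t)| ≤ 2 * d := by
      rw [abs_le]; constructor <;> linarith
    have h4 : |2 * s - 2 * t| ≤ 2 * d := by
      rw [abs_le]; constructor <;> linarith
    simp only [hu]
    constructor <;> linarith
  have ha : |arccot (Real.exp (u s s')) - arccot (Real.exp (u t t'))| ≤ 4 * d := by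
    refine le_trans ?_ hdu
    rw [abs_sub_comm (u s s')]
    refine le_trans (le_of_eq ?_) (abs_arctan_exp_sub_le _ _)
    congr 1
    unfold arccot
    ring
  have hb : |Real.sin (Real.arctan (Real.exp s)) - Real.sin (Real.arctan (Real.exp t))| ≤ d := by
    refine le_trans ?_ ((abs_arctan_exp_sub_le s t).trans hd)
    simpa [Real.dist_eq] using Real.lipschitzWith_sin.dist_le_mul (Real.arctan (Real.exp s))
      (Real.arctan (Real.exp t))
  have hA : |arccot (Real.exp (u t t'))| ≤ 2 := by
    rw [abs_of_pos (arccot_pos _)]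
    linarith [arccot_le_pi_div_two (Real.exp_pos (u t t')).le, Real.pi_le_four]
  have hB : |Real.sin (Real.arctan (Real.exp s))| ≤ 1 := Real.abs_sin_le_one _
  rw [hform, hform, ← mul_sub, abs_mul, abs_two]
  set a := arccot (Real.exp (u s s'))
  set a' := arccot (Real.exp (u t t'))
  set b := Real.sin (Real.arctan (Real.exp s))
  set b' := Real.sin (Real.arctan (Real.exp t))
  have hd0 : 0 ≤ d := (abs_nonneg _).trans hd
  -- With the prefactor 2 this gives 2 (4 + 2) d = 12 d.
  have : |b * a - b' * a'| ≤ 1 * (4 * d) + d * 2 := by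
    rw [show b * a - b' * a' = b * (a - a') + (b - b') * a' by ring]
    refine (abs_add_le _ _).trans ?_
    rw [abs_mul, abs_mul]
    gcongr
  linarith

end

end CirclePattern

namespace CirclePattern

/-! ### Monotonicity of the total geodesic curvatures -/

section

variable {E F : Type*} [Fintype E] [DecidableEq F] {f₁ f₂ : E → F} {Φ : E → ℝ}

/-- The closed formula for `totalCurvature` at nonnegative curvatures. -/
noncomputable def curvatureFormula (f₁ f₂ : E → F) (Φ : E → ℝ) (k : F → ℝ) (i : F) : ℝ :=
  ∑ e, ((if f₁ e = i then sideFormula (Φ e) (k i) (k (f₂ e)) else 0) +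
    (if f₂ e = i then sideFormula (Φ e) (k i) (k (f₁ e)) else 0))

theorem totalCurvature_eq (hΦ : ∀ e, Φ e ∈ Ioo 0 (Real.pi / 2)) {k : F → ℝ} (hk : ∀ i, 0 ≤ k i)
    (i : F) : totalCurvature f₁ f₂ Φ k i = curvatureFormula f₁ f₂ Φ k i := by
  simp only [totalCurvature, curvatureFormula, sideCurvature_eq (hΦ _) (hk _) (hk _)]

theorem continuous_curvatureFormula (hΦ : ∀ e, Φ e ∈ Ioo 0 (Real.pi / 2)) (i : F) :
    Continuous fun k : F → ℝ => curvatureFormula f₁ f₂ Φ k i := by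
  refine continuous_finsetSum _ fun e _ => Continuous.add ?_ ?_
  all_goals
    split_ifs
    · exact (continuous_sideFormula (hΦ e)).comp (f := fun k : F → ℝ => (k i, k _))
        ((continuous_apply _).prodMk (continuous_apply _))
    · exact continuous_const

/-- Only opposite curvatures change. An edge with `i` on both sides is harmless, since there the
opposite curvature is k i as well. -/
theorem curvatureFormula_anti (hΦ : ∀ e, Φ e ∈ Ioo 0 (Real.pi / 2)) {k l : F → ℝ} {i : F}
    (hk : 0 ≤ k i) (hi : k i = l i) (hkl : k ≤ l) :
    curvatureFormula f₁ f₂ Φ l i ≤ curvatureFormula f₁ f₂ Φ k i := by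
  refine Finset.sum_le_sum fun e _ => add_le_add ?_ ?_
  all_goals
    split_ifs
    · rw [← hi]
      exact sideFormula_antitone (hΦ e) hk (hkl _)
    · exact le_rfl

theorem curvatureFormula_eq_zero {k : F → ℝ} {i : F} (hi : k i = 0) :
    curvatureFormula f₁ f₂ Φ k i = 0 := by
  simp [curvatureFormula, hi, sideFormula_zero]

theorem curvatureFormula_pos {k : F → ℝ} {i : F} (hi : 0 < k i)
    (he : ∃ e, f₁ e = i ∨ f₂ e = i) : 0 < curvatureFormula f₁ f₂ Φ k i := by
  have h : ∀ (p : Prop) [Decidable p] (φ x : ℝ), 0 ≤ if p then sideFormula φ (k i) x else 0 :=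
    fun p _ φ x => by
      split_ifs
      · exact (sideFormula_pos hi x).le
      · exact le_rfl
  obtain ⟨e, he⟩ := he
  refine Finset.sum_pos' (fun e _ => add_nonneg (h _ _ _) (h _ _ _)) ⟨e, Finset.mem_univ _, ?_⟩
  rcases he with he | he
  · refine add_pos_of_pos_of_nonneg ?_ (h _ _ _)
    rw [if_pos he]
    exact sideFormula_pos hi _
  · refine add_pos_of_nonneg_of_pos (h _ _ _) ?_
    rw [if_pos he]
    exact sideFormula_pos hi _

/-- Every side at `i` gains strictly, so a single edge suffices. This turns multiples of a solution
into strict sub- and supersolutions. -/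
theorem curvatureFormula_lt_scale (hΦ : ∀ e, Φ e ∈ Ioo 0 (Real.pi / 2)) {k : F → ℝ} {i : F}
    (hk : ∀ j, 0 ≤ k j) (hi : 0 < k i) (he : ∃ e, f₁ e = i ∨ f₂ e = i) {c : ℝ} (hc : 1 < c) :
    curvatureFormula f₁ f₂ Φ k i < curvatureFormula f₁ f₂ Φ (c • k) i := by
  have hs : ∀ e j, sideFormula (Φ e) (k i) (k j) < sideFormula (Φ e) ((c • k) i) ((c • k) j) :=
    fun e j => sideFormula_lt_scale (hΦ e) hi (hk j) hc
  have h : ∀ (p : Prop) [Decidable p] (e : E) (j : F),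
      (if p then sideFormula (Φ e) (k i) (k j) else 0) ≤
        if p then sideFormula (Φ e) ((c • k) i) ((c • k) j) else 0 := fun p _ e j => by
    split_ifs
    · exact (hs e j).le
    · exact le_rfl
  obtain ⟨e, he⟩ := he
  refine Finset.sum_lt_sum (fun e _ => add_le_add (h _ _ _) (h _ _ _)) ⟨e, Finset.mem_univ _, ?_⟩
  rcases he with he | he
  · refine add_lt_add_of_lt_of_le ?_ (h _ _ _)
    rw [if_pos he, if_pos he]
    exact hs _ _
  · refine add_lt_add_of_le_of_lt (h _ _ _) ?_
    rw [if_pos he, if_pos he]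
    exact hs _ _

theorem curvatureFormula_le_scale (hΦ : ∀ e, Φ e ∈ Ioo 0 (Real.pi / 2)) {k : F → ℝ} {i : F}
    (hk : ∀ j, 0 ≤ k j) (hi : 0 < k i) (he : ∃ e, f₁ e = i ∨ f₂ e = i) {c : ℝ} (hc : 1 ≤ c) :
    curvatureFormula f₁ f₂ Φ k i ≤ curvatureFormula f₁ f₂ Φ (c • k) i := by
  rcases hc.eq_or_lt with rfl | hc
  · rw [one_smul]
  · exact (curvatureFormula_lt_scale hΦ hk hi he hc).le

theorem curvatureFormula_nonneg {k : F → ℝ} {i : F} (hi : 0 ≤ k i) :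
    0 ≤ curvatureFormula f₁ f₂ Φ k i := by
  refine Finset.sum_nonneg fun e _ => add_nonneg ?_ ?_
  all_goals
    split_ifs
    · exact sideFormula_nonneg hi _
    · exact le_rfl

/-- Each edge has at most two sides at `i`. The bound vanishes with k i, which yields small
subsolutions, and it is bounded overall, which bounds the flow field. -/
theorem curvatureFormula_le (hΦ : ∀ e, Φ e ∈ Ioo 0 (Real.pi / 2)) {k : F → ℝ}
    (hk : ∀ j, 0 ≤ k j) (i : F) :
    curvatureFormula f₁ f₂ Φ k i ≤
      Fintype.card E * (2 * (Real.pi * (k i / √(1 + k i ^ 2)))) := by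
  have hki := hk i
  have h : ∀ (p : Prop) [Decidable p] (e : E) (j : F),
      (if p then sideFormula (Φ e) (k i) (k j) else 0) ≤ Real.pi * (k i / √(1 + k i ^ 2)) :=
    fun p _ e j => by
      split_ifs
      · exact sideFormula_le_pi_mul (hΦ e) hki (hk j)
      · have := Real.pi_pos
        positivity
  refine (Finset.sum_le_card_nsmul _ _ (2 * (Real.pi * (k i / √(1 + k i ^ 2)))) fun e _ => ?_).trans
    (by simp)
  linarith [h (f₁ e = i) e (f₂ e), h (f₂ e = i) e (f₁ e)]

theorem abs_curvatureFormula_exp_sub_le (hΦ : ∀ e, Φ e ∈ Ioo 0 (Real.pi / 2)) {s t : F → ℝ} {d : ℝ}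
    (hd : ∀ j, |s j - t j| ≤ d) (i : F) :
    |curvatureFormula f₁ f₂ Φ (fun j => Real.exp (s j)) i -
      curvatureFormula f₁ f₂ Φ (fun j => Real.exp (t j)) i| ≤ Fintype.card E * (24 * d) := by
  have hd0 : 0 ≤ d := (abs_nonneg _).trans (hd i)
  have h : ∀ (p : Prop) [Decidable p] (e : E) (j : F),
      |(if p then sideFormula (Φ e) (Real.exp (s i)) (Real.exp (s j)) else 0) -
        if p then sideFormula (Φ e) (Real.exp (t i)) (Real.exp (t j)) else 0| ≤ 12 * d :=
    fun p _ e j => by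
      split_ifs
      · exact abs_sideFormula_exp_sub_le (hΦ e) (hd i) (hd j)
      · simpa using hd0
  rw [curvatureFormula, curvatureFormula, ← Finset.sum_sub_distrib]
  refine (Finset.abs_sum_le_sum_abs _ _).trans ?_
  refine (Finset.sum_le_card_nsmul _ _ (24 * d) fun e _ => ?_).trans (by simp)
  rw [add_sub_add_comm]
  refine (abs_add_le _ _).trans ?_
  linarith [h (f₁ e = i) e (f₂ e), h (f₂ e = i) e (f₁ e)]

theorem sum_curvatureFormula (k : F → ℝ) (A : Finset F) :
    ∑ i ∈ A, curvatureFormula f₁ f₂ Φ k i =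
      ∑ e, ((if f₁ e ∈ A then sideFormula (Φ e) (k (f₁ e)) (k (f₂ e)) else 0) +
        (if f₂ e ∈ A then sideFormula (Φ e) (k (f₂ e)) (k (f₁ e)) else 0)) := by
  simp only [curvatureFormula]
  rw [Finset.sum_comm]
  refine Finset.sum_congr rfl fun e _ => ?_
  rw [Finset.sum_add_distrib, Finset.sum_ite_eq, Finset.sum_ite_eq]

/-- A lower bound for the curvature that an edge contributes to a set of faces, if the faces in the
set have curvature at least `R` and the other ones have curvature at most `C`. -/
noncomputable def edgeLowerBound (φ C R : ℝ) : ℝ :=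
  min (2 * (R / √(1 + R ^ 2)) * φ)
    (2 * (R / √(1 + R ^ 2)) * arccot ((Real.cos φ + C / R) / Real.sin φ))

theorem tendsto_edgeLowerBound {φ : ℝ} (hφ : φ ∈ Ioo 0 (Real.pi / 2)) (C : ℝ) :
    Tendsto (edgeLowerBound φ C) atTop (𝓝 (2 * φ)) := by
  have h1 : Tendsto (fun R : ℝ => 2 * (R / √(1 + R ^ 2)) * φ) atTop (𝓝 (2 * φ)) := by
    simpa using (tendsto_div_sqrt_one_add_sq.const_mul 2).mul_const φ
  have h2 := h1.min (tendsto_sideFormula_lower_bound hφ C)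
  rwa [min_self] at h2

/-- An edge with both sides in A is controlled by the Euclidean angle sum, one with a single side in
A by the ratio k' / k ≤ C / R; the minimum covers both cases. -/
theorem sum_edgeLowerBound_le (hΦ : ∀ e, Φ e ∈ Ioo 0 (Real.pi / 2)) {k : F → ℝ}
    (hk : ∀ j, 0 ≤ k j) {A : Finset F} {C R : ℝ} (hR : 0 < R) (hA : ∀ i ∈ A, R ≤ k i)
    (hC : ∀ i ∉ A, k i ≤ C) :
    ∑ e ∈ boundaryEdges f₁ f₂ A, edgeLowerBound (Φ e) C R ≤
      ∑ i ∈ A, curvatureFormula f₁ f₂ Φ k i := by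
  rw [sum_curvatureFormula, boundaryEdges, Finset.sum_filter]
  refine Finset.sum_le_sum fun e _ => ?_
  by_cases h1 : f₁ e ∈ A <;> by_cases h2 : f₂ e ∈ A
  · simp only [h1, h2, if_true, or_self]
    exact (min_le_left _ _).trans (sideFormula_add_lower_bound (hΦ e) hR (hA _ h1) (hA _ h2))
  · simp only [h1, h2, if_true, or_false, if_false, add_zero]
    exact (min_le_right _ _).trans
      (sideFormula_lower_bound_of_le (hΦ e) hR (hA _ h1) (hk _) (hC _ h2))
  · simp only [h1, h2, if_true, or_true, if_false, zero_add]
    exact (min_le_right _ _).trans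
      (sideFormula_lower_bound_of_le (hΦ e) hR (hA _ h2) (hk _) (hC _ h1))
  · simp [h1, h2]

end

end CirclePattern

/-! ### Existence of the prescribed metric -/

theorem SupClosed.exists_forall_lt {F : Type*} {P : Set (F → ℝ)} (hP : SupClosed P)
    (hne : P.Nonempty) (A : Finset F) {a : F → ℝ} (h : ∀ i ∈ A, ∃ k ∈ P, a i < k i) :
    ∃ k ∈ P, ∀ i ∈ A, a i < k i := by
  classical
  induction A using Finset.induction_on with
  | empty => exact ⟨hne.some, hne.some_mem, by simp⟩
  | insert j A _ ih =>
    obtain ⟨k, hk, hkA⟩ := ih fun i hi => h i (Finset.mem_insert_of_mem hi)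
    obtain ⟨l, hl, hlj⟩ := h j (Finset.mem_insert_self _ _)
    refine ⟨k ⊔ l, hP hk hl, fun i hi => ?_⟩
    rcases Finset.mem_insert.1 hi with rfl | hi
    · exact lt_sup_of_lt_right hlj
    · exact lt_sup_of_lt_left (hkA i hi)

namespace CirclePattern

section

variable {E F : Type*} [Fintype E] [DecidableEq F] {f₁ f₂ : E → F} {Φ : E → ℝ}
  {I : Finset F} {Lhat : F → ℝ}

/-- The vectors supported on `I`, bounded below by `δ` there, whose total geodesic curvatures do not
exceed `Lhat` on `I`. -/
def subsolutions (f₁ f₂ : E → F) (Φ : E → ℝ) (I : Finset F) (Lhat : F → ℝ) (δ : ℝ) :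
    Set (F → ℝ) :=
  {k | (∀ i ∉ I, k i = 0) ∧ (∀ i ∈ I, δ ≤ k i) ∧
    ∀ i ∈ I, curvatureFormula f₁ f₂ Φ k i ≤ Lhat i}

theorem nonneg_of_mem_subsolutions {δ : ℝ} (hδ : 0 < δ) {k : F → ℝ}
    (hk : k ∈ subsolutions f₁ f₂ Φ I Lhat δ) (i : F) : 0 ≤ k i := by
  by_cases hi : i ∈ I
  · exact hδ.le.trans (hk.2.1 i hi)
  · exact (hk.1 i hi).ge

/-- At each face the join agrees with one of the two vectors and dominates it elsewhere, so the
curvature there can only drop. -/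
theorem supClosed_subsolutions (hΦ : ∀ e, Φ e ∈ Ioo 0 (Real.pi / 2)) {δ : ℝ} (hδ : 0 < δ) :
    SupClosed (subsolutions f₁ f₂ Φ I Lhat δ) := by
  intro k hk l hl
  refine ⟨fun i hi => by simp [hk.1 i hi, hl.1 i hi], fun i hi => (hk.2.1 i hi).trans le_sup_left,
    fun i hi => ?_⟩
  rcases le_total (k i) (l i) with h | h
  · exact (curvatureFormula_anti hΦ (nonneg_of_mem_subsolutions hδ hl i) (by simp [h])
      le_sup_right).trans (hl.2.2 i hi)
  · exact (curvatureFormula_anti hΦ (nonneg_of_mem_subsolutions hδ hk i) (by simp [h])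
      le_sup_left).trans (hk.2.2 i hi)

theorem isClosed_subsolutions (hΦ : ∀ e, Φ e ∈ Ioo 0 (Real.pi / 2)) (δ : ℝ) :
    IsClosed (subsolutions f₁ f₂ Φ I Lhat δ) := by
  have : subsolutions f₁ f₂ Φ I Lhat δ = (⋂ i ∉ I, {k | k i = 0}) ∩ ((⋂ i ∈ I, {k | δ ≤ k i}) ∩
      ⋂ i ∈ I, {k | curvatureFormula f₁ f₂ Φ k i ≤ Lhat i}) := by
    ext k; simp [subsolutions]
  rw [this]
  refine (isClosed_biInter fun i _ => ?_).inter
    ((isClosed_biInter fun i _ => ?_).inter (isClosed_biInter fun i _ => ?_))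
  · exact isClosed_eq (continuous_apply i) continuous_const
  · exact isClosed_le continuous_const (continuous_apply i)
  · exact isClosed_le (continuous_curvatureFormula hΦ i) continuous_const

theorem exists_pos_subsolutions_nonempty (hΦ : ∀ e, Φ e ∈ Ioo 0 (Real.pi / 2))
    (hL : ∀ i ∈ I, 0 < Lhat i) : ∃ δ > 0, (subsolutions f₁ f₂ Φ I Lhat δ).Nonempty := by
  have hev : ∀ᶠ δ : ℝ in 𝓝[>] 0, ∀ i ∈ I,
      Fintype.card E * (2 * (Real.pi * (δ / √(1 + δ ^ 2)))) < Lhat i := by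
    rw [eventually_all_finset]
    intro i hi
    refine Tendsto.eventually_lt_const (v := 0) (hL i hi) (Tendsto.mono_left ?_ nhdsWithin_le_nhds)
    have hc : Continuous fun δ : ℝ => Fintype.card E * (2 * (Real.pi * (δ / √(1 + δ ^ 2)))) := by
      have hq : ∀ x : ℝ, √(1 + x ^ 2) ≠ 0 := fun x => by positivity
      fun_prop (disch := assumption)
    simpa using hc.tendsto 0
  obtain ⟨δ, hδ, hδ0⟩ := (hev.and self_mem_nhdsWithin).exists
  refine ⟨δ, hδ0, fun i => if i ∈ I then δ else 0, fun i hi => by simp [hi],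
    fun i hi => by simp [hi], fun i hi => ?_⟩
  refine (curvatureFormula_le hΦ (fun j => ?_) i).trans ?_
  · split_ifs
    · exact hδ0.le
    · exact le_rfl
  · simpa [hi] using (hδ i hi).le

/-- The conditions on the prescribed curvatures bound the subsolutions. -/
theorem bddAbove_subsolutions [Fintype F] (hΦ : ∀ e, Φ e ∈ Ioo 0 (Real.pi / 2))
    (hL : Lhat ∈ prescribedCurvatures f₁ f₂ Φ I) {δ : ℝ} (hδ : 0 < δ)
    (hne : (subsolutions f₁ f₂ Φ I Lhat δ).Nonempty) (i : F) :
    BddAbove ((fun k : F → ℝ => k i) '' subsolutions f₁ f₂ Φ I Lhat δ) := by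
  classical
  set P := subsolutions f₁ f₂ Φ I Lhat δ
  -- The faces with unbounded coordinate; the inequality of 𝓛_I for this very set gives the
  -- contradiction.
  set A : Finset F := Finset.univ.filter fun i => ¬ BddAbove ((fun k : F → ℝ => k i) '' P) with hA
  by_contra hi
  have hAne : A.Nonempty := ⟨i, by simp [hA, hi]⟩
  have hAI : A ⊆ I := fun j hj => by
    by_contra hjI
    rw [hA, Finset.mem_filter] at hj
    refine hj.2 ⟨0, ?_⟩
    rintro _ ⟨k, hk, rfl⟩
    exact (hk.1 j hjI).le
  have hbd : ∀ j, ∃ C, j ∉ A → ∀ k ∈ P, k j ≤ C := fun j => by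
    by_cases hj : j ∈ A
    · exact ⟨0, fun h => absurd hj h⟩
    · have : BddAbove ((fun k : F → ℝ => k j) '' P) := by
        by_contra h; exact hj (by simp [hA, h])
      obtain ⟨C, hC⟩ := this
      exact ⟨C, fun _ k hk => hC ⟨k, hk, rfl⟩⟩
  choose C hC using hbd
  obtain ⟨D, hD⟩ := (Set.finite_range C).bddAbove
  have hlim : Tendsto (fun R => ∑ e ∈ boundaryEdges f₁ f₂ A, edgeLowerBound (Φ e) D R) atTop
      (𝓝 (∑ e ∈ boundaryEdges f₁ f₂ A, 2 * Φ e)) :=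
    tendsto_finsetSum _ fun e _ => tendsto_edgeLowerBound (hΦ e) D
  rw [← Finset.mul_sum] at hlim
  obtain ⟨R, hR, hR0⟩ :=
    ((hlim.eventually_const_lt (hL.2.2 A hAI hAne)).and (eventually_gt_atTop 0)).exists
  -- Closure under joins gives one subsolution that exceeds `R` on all of `A` simultaneously.
  obtain ⟨k, hk, hkA⟩ := (supClosed_subsolutions hΦ hδ).exists_forall_lt hne A (a := fun _ => R)
    fun j hj => by
      rw [hA, Finset.mem_filter, not_bddAbove_iff] at hj
      obtain ⟨_, ⟨k, hk, rfl⟩, hlt⟩ := hj.2 R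
      exact ⟨k, hk, hlt⟩
  have h1 := sum_edgeLowerBound_le (f₁ := f₁) (f₂ := f₂) hΦ (nonneg_of_mem_subsolutions hδ hk) hR0
    (fun j hj => (hkA j hj).le) (fun j hj => (hC j hj k hk).trans (hD ⟨j, rfl⟩))
  have h2 : ∑ j ∈ A, curvatureFormula f₁ f₂ Φ k j ≤ ∑ j ∈ A, Lhat j :=
    Finset.sum_le_sum fun j hj => hk.2.2 j (hAI hj)
  linarith

/-- The supremum of the subsolutions is itself one. If its curvature at some i ∈ I were too small,
raising coordinate i slightly would keep it a subsolution: continuity handles i, antitonicity the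
other faces. -/
theorem exists_mem_stratum_curvatureFormula_eq [Fintype F]
    (hΦ : ∀ e, Φ e ∈ Ioo 0 (Real.pi / 2))
    (hL : Lhat ∈ prescribedCurvatures f₁ f₂ Φ I) :
    ∃ k ∈ stratum I, ∀ i, curvatureFormula f₁ f₂ Φ k i = Lhat i := by
  obtain ⟨δ, hδ, hne⟩ := exists_pos_subsolutions_nonempty (f₁ := f₁) (f₂ := f₂) hΦ hL.1
  have hbdd := bddAbove_subsolutions hΦ hL hδ hne
  set P := subsolutions f₁ f₂ Φ I Lhat δ with hP
  set m : F → ℝ := fun i => sSup ((fun k : F → ℝ => k i) '' P) with hm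
  have hle : ∀ k ∈ P, k ≤ m := fun k hk i => le_csSup (hbdd i) ⟨k, hk, rfl⟩
  have hmP : m ∈ P := by
    rw [hP, ← (isClosed_subsolutions hΦ δ).closure_eq, Metric.mem_closure_iff]
    intro ε hε
    obtain ⟨k, hk, hkm⟩ := (supClosed_subsolutions hΦ hδ).exists_forall_lt hne Finset.univ
      (a := fun i => m i - ε / 2) fun i _ => by
        obtain ⟨_, ⟨k, hk, rfl⟩, hlt⟩ := exists_lt_of_lt_csSup (hne.image fun k : F → ℝ => k i)
          (show m i - ε / 2 < sSup ((fun k : F → ℝ => k i) '' P) by simp only [hm]; linarith)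
        exact ⟨k, hk, hlt⟩
    refine ⟨k, hk, (dist_pi_lt_iff hε).2 fun i => ?_⟩
    have h1 := hle k hk i
    have h2 := hkm i (Finset.mem_univ i)
    rw [Real.dist_eq, abs_lt]
    constructor <;> linarith
  have hm0 := nonneg_of_mem_subsolutions hδ hmP
  refine ⟨m, ⟨fun i hi => hδ.trans_le (hmP.2.1 i hi), hmP.1⟩, fun i => ?_⟩
  by_cases hi : i ∈ I
  swap
  · rw [curvatureFormula_eq_zero (hmP.1 i hi), hL.2.1 i hi]
  refine (hmP.2.2 i hi).eq_or_lt.resolve_right fun hlt => ?_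
  have hcont : Tendsto (fun y : ℝ => curvatureFormula f₁ f₂ Φ (Function.update m i y) i)
      (𝓝[>] (m i)) (𝓝 (curvatureFormula f₁ f₂ Φ m i)) := by
    have h : Continuous fun y : ℝ => curvatureFormula f₁ f₂ Φ (Function.update m i y) i :=
      (continuous_curvatureFormula hΦ i).comp (continuous_const.update i continuous_id)
    have := (h.tendsto (m i)).mono_left (nhdsWithin_le_nhds (s := Ioi (m i)))
    rwa [Function.update_eq_self] at this
  obtain ⟨y, hy, hym⟩ := ((hcont.eventually_lt_const hlt).and self_mem_nhdsWithin).exists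
  have hmem : Function.update m i y ∈ P := by
    refine ⟨fun j hj => ?_, fun j hj => ?_, fun j hj => ?_⟩
    · rw [Function.update_of_ne fun h : j = i => hj (h ▸ hi)]
      exact hmP.1 j hj
    · exact (hmP.2.1 j hj).trans (le_update_iff.2 ⟨hym.le, fun _ _ => le_rfl⟩ j)
    · by_cases hji : j = i
      · subst hji
        exact hy.le
      · refine (curvatureFormula_anti hΦ (hm0 j) ?_ ?_).trans (hmP.2.2 j hj)
        · rw [Function.update_of_ne hji]
        · exact le_update_iff.2 ⟨hym.le, fun _ _ => le_rfl⟩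
  have := hle _ hmem i
  rw [Function.update_self] at this
  linarith

end

end CirclePattern

/-! ### Global solutions and barriers for ordinary differential equations -/

/-- A bounded Lipschitz vector field has global integral curves. -/
theorem exists_forall_hasDerivAt_of_lipschitzWith {X : Type*} [NormedAddCommGroup X]
    [NormedSpace ℝ X] [CompleteSpace X] {v : X → X} {K M : NNReal} (hv : LipschitzWith K v)
    (hM : ∀ x, ‖v x‖ ≤ M) (x₀ : X) :
    ∃ α : ℝ → X, α 0 = x₀ ∧ ∀ t, HasDerivAt α (v (α t)) t := by
  have hloc : ∀ n : ℕ, ∃ α : ℝ → X, α 0 = x₀ ∧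
      ∀ t ∈ Ioo (-(n + 1 : ℝ)) (n + 1), HasDerivAt α (v (α t)) t := fun n => by
    have h0 : (0 : ℝ) ∈ Icc (-(n + 1 : ℝ)) (n + 1) := ⟨by linarith, by positivity⟩
    -- At speed at most `M`, a solution stays within distance M (n + 1) of `x₀` during this time.
    have hPL : IsPicardLindelof (fun _ => v) (⟨0, h0⟩ : Icc (-(n + 1 : ℝ)) (n + 1)) x₀
        (M * (n + 1)) 0 M K :=
      IsPicardLindelof.of_time_independent (fun x _ => hM x) hv.lipschitzOnWith (by simp)
    obtain ⟨α, hα, hα'⟩ := hPL.exists_eq_forall_mem_Icc_hasDerivWithinAt₀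
    exact ⟨α, hα, fun t ht =>
      (hα' t (Ioo_subset_Icc_self ht)).hasDerivAt (Icc_mem_nhds ht.1 ht.2)⟩
  choose α hα hα' using hloc
  have heq : ∀ {n m : ℕ}, n ≤ m → EqOn (α n) (α m) (Ioo (-(n + 1 : ℝ)) (n + 1)) := fun {n m} h => by
    have hnm : (n : ℝ) ≤ m := Nat.cast_le.2 h
    refine ODE_solution_unique_of_mem_Ioo (v := fun _ => v) (s := fun _ => univ) (t₀ := 0)
      (fun t _ => hv.lipschitzOnWith) ⟨by linarith, by positivity⟩
      (fun t ht => ⟨hα' n t ht, mem_univ _⟩) (fun t ht => ⟨hα' m t ?_, mem_univ _⟩) (by rw [hα, hα])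
    exact ⟨by linarith [ht.1], by linarith [ht.2]⟩
  have hmem : ∀ {n : ℕ} {t : ℝ}, |t| ≤ n → t ∈ Ioo (-(n + 1 : ℝ)) (n + 1) := fun {n t} h => by
    rw [abs_le] at h
    exact ⟨by linarith, by linarith⟩
  refine ⟨fun t => α ⌈|t|⌉₊ t, by simp [hα], fun t₀ => ?_⟩
  -- The extra 1 makes the glued curve agree with `α N` on a whole neighbourhood of `t₀`.
  set N := ⌈|t₀|⌉₊ + 1
  have hN : |t₀| + 1 ≤ N := by
    simpa [N] using Nat.le_ceil |t₀|
  have hev : (fun t => α ⌈|t|⌉₊ t) =ᶠ[𝓝 t₀] α N := by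
    have : ∀ᶠ t in 𝓝 t₀, |t| < |t₀| + 1 :=
      (continuous_abs.tendsto t₀).eventually_lt_const (by linarith)
    filter_upwards [this] with t ht
    exact heq (Nat.ceil_le.2 (ht.le.trans hN)) (hmem (Nat.le_ceil _))
  have hd := hα' N t₀ (hmem (by linarith))
  rw [← hev.eq_of_nhds] at hd
  exact hd.congr_of_eventuallyEq hev

/-- If a finite family of functions starts below a barrier and moves down relative to the barrier
whenever its maximum touches it, then it stays below the barrier. -/
theorem forall_lt_of_deriv_lt_of_eq {ι : Type*} [Finite ι] {u u' : ℝ → ι → ℝ} {B B' : ℝ → ℝ}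
    (hu : ∀ t, 0 ≤ t → ∀ i, HasDerivAt (fun s => u s i) (u' t i) t)
    (hB : ∀ t, 0 ≤ t → HasDerivAt B (B' t) t) (h0 : ∀ i, u 0 i < B 0)
    (hcross : ∀ t, 0 ≤ t → ∀ i, (∀ j, u t j ≤ u t i) → u t i = B t → u' t i < B' t)
    {t : ℝ} (ht : 0 ≤ t) (i : ι) : u t i < B t := by
  by_contra! hcon
  set Z : Set ℝ := ⋃ j, {s ∈ Icc 0 t | B s ≤ u s j} with hZ
  have hBc : ContinuousOn B (Icc 0 t) := fun s hs => (hB s hs.1).continuousAt.continuousWithinAt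
  have huc : ∀ j, ContinuousOn (fun s => u s j) (Icc 0 t) :=
    fun j s hs => (hu s hs.1 j).continuousAt.continuousWithinAt
  have hZc : IsClosed Z :=
    isClosed_iUnion_of_finite fun j => isClosed_Icc.isClosed_le hBc (huc j)
  have hZne : Z.Nonempty := ⟨t, mem_iUnion.2 ⟨i, ⟨ht, le_rfl⟩, hcon⟩⟩
  have hZb : BddBelow Z := ⟨0, fun s hs => by
    obtain ⟨j, hj⟩ := mem_iUnion.1 hs
    exact hj.1.1⟩
  set τ := sInf Z
  obtain ⟨j, hτj⟩ := mem_iUnion.1 (hZc.csInf_mem hZne hZb)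
  have hτ : τ ∈ Icc 0 t := hτj.1
  have hj : B τ ≤ u τ j := hτj.2
  have hbelow : ∀ s, 0 ≤ s → s < τ → ∀ l, u s l < B s := fun s hs hsτ l => by
    by_contra! h
    exact (notMem_of_lt_csInf hsτ hZb) (mem_iUnion.2 ⟨l, ⟨hs, hsτ.le.trans hτ.2⟩, h⟩)
  have hτ0 : 0 < τ := hτ.1.lt_of_ne fun h => by
    rw [← h] at hj
    exact (h0 j).not_ge hj
  have hleft : ∀ᶠ s in 𝓝[<] τ, 0 ≤ s ∧ s < τ := by
    filter_upwards [Ioo_mem_nhdsLT hτ0] with s hs using ⟨hs.1.le, hs.2⟩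
  have hle : ∀ l, u τ l ≤ B τ := fun l =>
    le_of_tendsto_of_tendsto ((hu τ hτ.1 l).continuousAt.mono_left nhdsWithin_le_nhds)
      ((hB τ hτ.1).continuousAt.mono_left (nhdsWithin_le_nhds (s := Iio τ)))
      (hleft.mono fun s hs => (hbelow s hs.1 hs.2 l).le)
  have heq : u τ j = B τ := le_antisymm (hle j) hj
  have hlt := hcross τ hτ.1 j (fun l => heq ▸ hle l) heq
  -- At the first contact time the difference u - B has negative derivative, but it is negative
  -- before and zero at contact, so its left slopes are positive.
  have hw := ((hu τ hτ.1 j).sub (hB τ hτ.1)).tendsto_slope.mono_left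
    (nhdsWithin_mono τ (show Iio τ ⊆ {τ}ᶜ from fun s hs => ne_of_lt hs))
  obtain ⟨s, hs, hs0, hsτ⟩ := ((hw.eventually_lt_const (sub_neg.2 hlt)).and hleft).exists
  rw [slope_def_field] at hs
  simp only [Pi.sub_apply] at hs
  rw [heq, sub_self, sub_zero, div_neg_iff] at hs
  have := hbelow s hs0 hsτ j
  rcases hs with h | h
  · linarith [h.1]
  · linarith [h.2]

/-- If the largest member of a finite family decreases at a definite rate as long as it is
nonnegative, then the family is eventually bounded by any positive number. -/
theorem eventually_lt_of_deriv_le_neg {ι : Type*} [Finite ι] {u u' : ℝ → ι → ℝ} {c : ℝ}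
    (hc : 0 < c) (hu : ∀ t, 0 ≤ t → ∀ i, HasDerivAt (fun s => u s i) (u' t i) t)
    (hmax : ∀ t, 0 ≤ t → ∀ i, (∀ j, u t j ≤ u t i) → 0 ≤ u t i → u' t i ≤ -c)
    {η : ℝ} (hη : 0 < η) : ∀ᶠ t in atTop, ∀ i, u t i < η := by
  obtain ⟨D, hD⟩ := (finite_range (u 0)).bddAbove
  set A := max D 0 + 1
  have hA : 0 < A := by positivity
  -- With A δ = c / 2 the barrier A exp(-δ t) sinks more slowly than the maximum of the family, so
  -- it is never crossed.
  set δ := c / (2 * A)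
  have hδ : 0 < δ := by positivity
  have hbar : ∀ t, 0 ≤ t → ∀ i, u t i < A * Real.exp (-δ * t) := fun t ht i => by
    refine forall_lt_of_deriv_lt_of_eq (B := fun t => A * Real.exp (-δ * t))
      (B' := fun t => A * (Real.exp (-δ * t) * (-δ * 1))) hu
      (fun s _ => (((hasDerivAt_id s).const_mul (-δ)).exp).const_mul A) (fun j => ?_) ?_ ht i
    · have h1 : u 0 j ≤ D := hD ⟨j, rfl⟩
      have h2 : D ≤ max D 0 := le_max_left _ _
      simp only [mul_zero, Real.exp_zero, mul_one, A]
      linarith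
    · intro s hs j hj hjB
      have h1 := hmax s hs j hj (by rw [hjB]; positivity)
      have h2 : Real.exp (-δ * s) ≤ 1 := Real.exp_le_one_iff.2 (by nlinarith)
      have h3 : A * δ = c / 2 := by simp only [δ]; field_simp
      have h4 : A * (Real.exp (-δ * s) * (-δ * 1)) = -(c / 2 * Real.exp (-δ * s)) := by
        rw [← h3]; ring
      rw [h4]
      nlinarith
  have hlim : Tendsto (fun t => A * Real.exp (-δ * t)) atTop (𝓝 0) := by
    have : Tendsto (fun t => -δ * t) atTop atBot := tendsto_id.const_mul_atTop_of_neg (by linarith)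
    simpa using (Real.tendsto_exp_atBot.comp this).const_mul A
  filter_upwards [hlim.eventually_lt_const hη, eventually_ge_atTop 0] with t ht h0 i
  exact (hbar t h0 i).trans ht

theorem Finite.exists_pos_forall_le {ι : Type*} [Finite ι] {f : ι → ℝ} (hf : ∀ i, 0 < f i) :
    ∃ c > 0, ∀ i, c ≤ f i := by
  rcases isEmpty_or_nonempty ι with h | h
  · exact ⟨1, one_pos, fun i => h.elim i⟩
  · obtain ⟨i, hi⟩ := Finite.exists_min f
    exact ⟨f i, hf i, hi⟩

namespace CirclePattern

/-! ### The flow in logarithmic coordinates -/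

section

variable {E F : Type*} [Fintype E] [DecidableEq F] {f₁ f₂ : E → F} {Φ : E → ℝ}
  {I : Finset F} {Lhat : F → ℝ}

/-- The vector field of the prescribed flow in the coordinates `log k`. -/
noncomputable def logField (f₁ f₂ : E → F) (Φ : E → ℝ) (Lhat : F → ℝ) (s : F → ℝ) : F → ℝ :=
  fun i => Lhat i - curvatureFormula f₁ f₂ Φ (fun j => Real.exp (s j)) i

theorem lipschitzWith_logField [Fintype F] (hΦ : ∀ e, Φ e ∈ Ioo 0 (Real.pi / 2)) :
    LipschitzWith (Fintype.card E * 24) (logField f₁ f₂ Φ Lhat) := by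
  refine LipschitzWith.of_dist_le_mul fun s t => ?_
  refine (dist_pi_le_iff (by positivity)).2 fun i => ?_
  rw [Real.dist_eq, logField, logField, sub_sub_sub_cancel_left, abs_sub_comm]
  refine (abs_curvatureFormula_exp_sub_le hΦ (d := dist s t) (fun j => ?_) i).trans (le_of_eq ?_)
  · rw [← Real.dist_eq]
    exact dist_le_pi_dist s t j
  · push_cast; ring

theorem exists_norm_logField_le [Fintype F] (hΦ : ∀ e, Φ e ∈ Ioo 0 (Real.pi / 2)) :
    ∃ M : NNReal, ∀ s, ‖logField f₁ f₂ Φ Lhat s‖ ≤ M := by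
  refine ⟨⟨‖Lhat‖ + Fintype.card E * (2 * (Real.pi * 1)), by positivity⟩, fun s => ?_⟩
  refine (pi_norm_le_iff_of_nonneg (NNReal.coe_nonneg _)).2 fun i => ?_
  refine (norm_sub_le _ _).trans (add_le_add (norm_le_pi_norm _ i) ?_)
  rw [Real.norm_of_nonneg (curvatureFormula_nonneg (k := fun j => Real.exp (s j))
    (Real.exp_pos (s i)).le)]
  refine (curvatureFormula_le hΦ (fun j => (Real.exp_pos _).le) i).trans ?_
  have := div_sqrt_one_add_sq_le_one (Real.exp (s i))
  gcongr

/-- In logarithmic coordinates a solution of the flow is an integral curve of `logField`. -/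
theorem IsFlowOn.hasDerivWithinAt_log [Fintype F] (hΦ : ∀ e, Φ e ∈ Ioo 0 (Real.pi / 2))
    (hL : ∀ i ∉ I, Lhat i = 0) {J : Set ℝ} {k : ℝ → F → ℝ} (hk : IsFlowOn f₁ f₂ Φ I Lhat J k)
    {t : ℝ} (ht : t ∈ J) :
    HasDerivWithinAt (fun s i => Real.log (k s i))
      (logField f₁ f₂ Φ Lhat fun i => Real.log (k t i)) J t := by
  rw [hasDerivWithinAt_pi]
  intro i
  have hpos := (hk t ht i).1
  refine ((hk t ht i).2.log hpos.ne').congr_deriv ?_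
  have hexp : (fun j => Real.exp (Real.log (k t j))) = k t :=
    funext fun j => Real.exp_log (hk t ht j).1
  simp only [logField]
  rw [hexp, totalCurvature_eq hΦ fun j => (hk t ht j).1.le]
  split_ifs with hi
  · field_simp; ring
  · rw [hL i hi]; field_simp; ring

theorem isFlowOn_exp [Fintype F] (hΦ : ∀ e, Φ e ∈ Ioo 0 (Real.pi / 2))
    (hL : ∀ i ∉ I, Lhat i = 0) {s : ℝ → F → ℝ}
    (hs : ∀ t, HasDerivAt s (logField f₁ f₂ Φ Lhat (s t)) t) (J : Set ℝ) :
    IsFlowOn f₁ f₂ Φ I Lhat J fun t i => Real.exp (s t i) := by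
  intro t _ i
  refine ⟨Real.exp_pos _, ?_⟩
  have h := ((hasDerivAt_pi.1 (hs t) i).exp).hasDerivWithinAt (s := J)
  refine h.congr_deriv ?_
  simp only [logField]
  rw [totalCurvature_eq hΦ fun j => (Real.exp_pos (s t j)).le]
  split_ifs with hi
  · ring
  · rw [hL i hi]; ring

theorem IsFlowOn.eqOn [Fintype F] (hΦ : ∀ e, Φ e ∈ Ioo 0 (Real.pi / 2))
    (hL : ∀ i ∉ I, Lhat i = 0) {T : ℝ} {k l : ℝ → F → ℝ}
    (hk : IsFlowOn f₁ f₂ Φ I Lhat (Ico 0 T) k) (hl : IsFlowOn f₁ f₂ Φ I Lhat (Ico 0 T) l)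
    (h0 : k 0 = l 0) : EqOn k l (Ico 0 T) := by
  intro t ht
  have hsub : Icc 0 t ⊆ Ico 0 T := fun x hx => ⟨hx.1, hx.2.trans_lt ht.2⟩
  have hd : ∀ {m : ℝ → F → ℝ}, IsFlowOn f₁ f₂ Φ I Lhat (Ico 0 T) m → ∀ x ∈ Ico 0 t,
      HasDerivWithinAt (fun s i => Real.log (m s i))
        (logField f₁ f₂ Φ Lhat fun i => Real.log (m x i)) (Ici x) x := fun hm x hx => by
    have hxT : x ∈ Ico 0 T := hsub ⟨hx.1, hx.2.le⟩
    refine (hm.hasDerivWithinAt_log hΦ hL hxT).mono_of_mem_nhdsWithin ?_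
    exact mem_of_superset (Ico_mem_nhdsGE hxT.2) (Ico_subset_Ico_left hx.1)
  have hc : ∀ {m : ℝ → F → ℝ}, IsFlowOn f₁ f₂ Φ I Lhat (Ico 0 T) m →
      ContinuousOn (fun s i => Real.log (m s i)) (Icc 0 t) := fun hm x hx =>
    (hm.hasDerivWithinAt_log hΦ hL (hsub hx)).continuousWithinAt.mono hsub
  have := ODE_solution_unique (v := fun _ => logField f₁ f₂ Φ Lhat)
    (fun _ => lipschitzWith_logField hΦ) (hc hk) (hd hk) (hc hl) (hd hl) (by simp [h0])
    (right_mem_Icc.2 ht.1)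
  funext i
  exact Real.log_injOn_pos (hk t ht i).1 (hl t ht i).1 (congrFun this i)

/-! ### Convergence of the flow -/

/-- Where log k - log l attains its maximum m ≥ 0, k ≤ exp(m) l with equality at i. Hence L_i(k) ≥
L_i(exp(m) l) ≥ L_i(l), which exceeds Lhat_i by a fixed amount, and the maximum decays. -/
theorem eventually_lt_of_lt_curvatureFormula [Fintype F] (hΦ : ∀ e, Φ e ∈ Ioo 0 (Real.pi / 2))
    (hE : ∀ i, ∃ e, f₁ e = i ∨ f₂ e = i) {s : ℝ → F → ℝ}
    (hs : ∀ t, HasDerivAt s (logField f₁ f₂ Φ Lhat (s t)) t) {l : F → ℝ} (hl : ∀ i, 0 < l i)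
    (hsuper : ∀ i, Lhat i < curvatureFormula f₁ f₂ Φ l i) {i : F} {b : ℝ} (hb : l i < b) :
    ∀ᶠ t in atTop, Real.exp (s t i) < b := by
  obtain ⟨c, hc, hc'⟩ := Finite.exists_pos_forall_le fun i => sub_pos.2 (hsuper i)
  have hlog : Real.log (l i) < Real.log b := Real.log_lt_log (hl i) hb
  have := eventually_lt_of_deriv_le_neg (u := fun t i => s t i - Real.log (l i))
    (u' := fun t i => logField f₁ f₂ Φ Lhat (s t) i) hc
    (fun t _ i => (hasDerivAt_pi.1 (hs t) i).sub_const _) (fun t _ i hmax h0 => ?_)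
    (sub_pos.2 hlog)
  · filter_upwards [this] with t ht
    rw [← Real.lt_log_iff_exp_lt ((hl i).trans hb)]
    linarith [ht i]
  · set m := s t i - Real.log (l i) with hm
    have h1 : curvatureFormula f₁ f₂ Φ (Real.exp m • l) i ≤
        curvatureFormula f₁ f₂ Φ (fun j => Real.exp (s t j)) i := by
      refine curvatureFormula_anti hΦ (Real.exp_pos _).le ?_ fun j => ?_
      · simp only [Pi.smul_apply, smul_eq_mul]
        rw [hm, Real.exp_sub, Real.exp_log (hl i), div_mul_cancel₀ _ (hl i).ne']
      · simp only [Pi.smul_apply, smul_eq_mul]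
        rw [← Real.exp_log (hl j), ← Real.exp_add, Real.exp_le_exp]
        linarith [hmax j]
    have h2 := curvatureFormula_le_scale hΦ (fun j => (hl j).le) (hl i) (hE i)
      (Real.one_le_exp h0)
    have := hc' i
    simp only [logField]
    linarith

/-- The mirror image, with the maximum taken over I only: off I the vector l vanishes, so there
exp(-m) l ≤ k is automatic. -/
theorem eventually_gt_of_curvatureFormula_lt [Fintype F] (hΦ : ∀ e, Φ e ∈ Ioo 0 (Real.pi / 2))
    (hE : ∀ i, ∃ e, f₁ e = i ∨ f₂ e = i) {s : ℝ → F → ℝ}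
    (hs : ∀ t, HasDerivAt s (logField f₁ f₂ Φ Lhat (s t)) t) {l : F → ℝ} (hl : l ∈ stratum I)
    (hsub : ∀ i ∈ I, curvatureFormula f₁ f₂ Φ l i < Lhat i) {i : F} (hi : i ∈ I) {a : ℝ}
    (ha : a < l i) : ∀ᶠ t in atTop, a < Real.exp (s t i) := by
  rcases le_or_gt a 0 with ha0 | ha0
  · exact Eventually.of_forall fun t => ha0.trans_lt (Real.exp_pos _)
  obtain ⟨c, hc, hc'⟩ := Finite.exists_pos_forall_le fun i : I => sub_pos.2 (hsub i i.2)
  have hlog : Real.log a < Real.log (l i) := Real.log_lt_log ha0 ha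
  have := eventually_lt_of_deriv_le_neg (u := fun t (i : I) => Real.log (l i) - s t i)
    (u' := fun t i => -logField f₁ f₂ Φ Lhat (s t) i) hc
    (fun t _ i => (hasDerivAt_pi.1 (hs t) i).const_sub _) (fun t _ i hmax h0 => ?_)
    (sub_pos.2 hlog)
  · filter_upwards [this] with t ht
    rw [← Real.log_lt_iff_lt_exp ha0]
    linarith [ht ⟨i, hi⟩]
  · set m := Real.log (l i) - s t i with hm
    have hl0 : ∀ j, 0 ≤ l j := fun j => by
      by_cases hj : j ∈ I
      · exact (hl.1 j hj).le
      · exact (hl.2 j hj).ge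
    have hli := hl.1 i i.2
    set z : F → ℝ := Real.exp (-m) • l with hz
    have hz0 : ∀ j, 0 ≤ z j := fun j => mul_nonneg (Real.exp_pos _).le (hl0 j)
    have hzi : z i = Real.exp (s t i) := by
      simp only [hz, Pi.smul_apply, smul_eq_mul]
      rw [hm, neg_sub, Real.exp_sub, Real.exp_log hli, div_mul_cancel₀ _ hli.ne']
    have h1 : curvatureFormula f₁ f₂ Φ (fun j => Real.exp (s t j)) i ≤
        curvatureFormula f₁ f₂ Φ z i := by
      refine curvatureFormula_anti hΦ (hz0 i) hzi fun j => ?_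
      by_cases hj : j ∈ I
      · simp only [hz, Pi.smul_apply, smul_eq_mul]
        rw [← Real.exp_log (hl.1 j hj), ← Real.exp_add, Real.exp_le_exp]
        linarith [hmax ⟨j, hj⟩]
      · simp only [hz, Pi.smul_apply, smul_eq_mul, hl.2 j hj, mul_zero]
        exact (Real.exp_pos _).le
    have h2 := curvatureFormula_le_scale hΦ hz0 (hzi ▸ Real.exp_pos _) (hE i) (Real.one_le_exp h0)
    have h3 : Real.exp m • z = l := by
      rw [hz, smul_smul, ← Real.exp_add, add_neg_cancel, Real.exp_zero, one_smul]
    rw [h3] at h2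
    have := hc' i
    simp only [logField]
    linarith

/-- A multiple c k with c > 1 is strict on I but zero elsewhere. Replacing the zeros by a small y >
0 preserves strictness on I by continuity, and off I any positive curvature beats Lhat = 0. -/
theorem exists_strict_supersolution [Fintype F] (hΦ : ∀ e, Φ e ∈ Ioo 0 (Real.pi / 2))
    (hE : ∀ i, ∃ e, f₁ e = i ∨ f₂ e = i) (hL : ∀ i ∉ I, Lhat i = 0) {k : F → ℝ}
    (hk : k ∈ stratum I) (hkL : ∀ i, curvatureFormula f₁ f₂ Φ k i = Lhat i) {i : F} {b : ℝ}
    (hb : k i < b) :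
    ∃ l : F → ℝ, (∀ j, 0 < l j) ∧ (∀ j, Lhat j < curvatureFormula f₁ f₂ Φ l j) ∧ l i < b := by
  have hk0 : ∀ j, 0 ≤ k j := fun j => by
    by_cases hj : j ∈ I
    · exact (hk.1 j hj).le
    · exact (hk.2 j hj).ge
  obtain ⟨c, hcb, hc⟩ : ∃ c, c * k i < b ∧ 1 < c := by
    have : Tendsto (fun c => c * k i) (𝓝[>] 1) (𝓝 (k i)) := by
      have h : Continuous fun c => c * k i := by fun_prop
      simpa using (h.tendsto 1).mono_left (nhdsWithin_le_nhds (s := Ioi 1))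
    exact ((this.eventually_lt_const hb).and self_mem_nhdsWithin).exists
  set l : ℝ → F → ℝ := fun y j => if j ∈ I then c * k j else y with hl
  have hlc : Continuous l := continuous_pi fun j => by
    by_cases hj : j ∈ I
    · simpa [hl, hj] using continuous_const
    · simpa [hl, hj] using continuous_id'
  have hl0 : l 0 = c • k := by
    ext j
    by_cases hj : j ∈ I
    · simp [hl, hj]
    · simp [hl, hj, hk.2 j hj]
  have h1 : ∀ᶠ y in 𝓝[>] (0 : ℝ), ∀ j ∈ I, Lhat j < curvatureFormula f₁ f₂ Φ (l y) j := by
    rw [eventually_all_finset]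
    intro j hj
    have := (((continuous_curvatureFormula (f₁ := f₁) (f₂ := f₂) hΦ j).comp hlc).tendsto
      0).mono_left (nhdsWithin_le_nhds (s := Ioi 0))
    refine this.eventually_const_lt ?_
    rw [Function.comp_apply, hl0, ← hkL j]
    exact curvatureFormula_lt_scale hΦ hk0 (hk.1 j hj) (hE j) hc
  have h2 : ∀ᶠ y in 𝓝[>] (0 : ℝ), l y i < b := by
    have := (((continuous_apply i).comp hlc).tendsto 0).mono_left
      (nhdsWithin_le_nhds (s := Ioi 0))
    refine this.eventually_lt_const ?_
    simpa [hl0] using hcb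
  obtain ⟨y, ⟨hy1, hy2⟩, hy⟩ := ((h1.and h2).and self_mem_nhdsWithin).exists
  have hpos : ∀ j, 0 < l y j := fun j => by
    by_cases hj : j ∈ I
    · simpa [hl, hj] using mul_pos (zero_lt_one.trans hc) (hk.1 j hj)
    · simpa [hl, hj] using hy
  refine ⟨l y, hpos, fun j => ?_, hy2⟩
  by_cases hj : j ∈ I
  · exact hy1 j hj
  · rw [hL j hj]
    exact curvatureFormula_pos (hpos j) (hE j)

theorem tendsto_exp_of_curvatureFormula_eq [Fintype F] (hΦ : ∀ e, Φ e ∈ Ioo 0 (Real.pi / 2))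
    (hE : ∀ i, ∃ e, f₁ e = i ∨ f₂ e = i) (hL : ∀ i ∉ I, Lhat i = 0) {k : F → ℝ}
    (hk : k ∈ stratum I) (hkL : ∀ i, curvatureFormula f₁ f₂ Φ k i = Lhat i) {s : ℝ → F → ℝ}
    (hs : ∀ t, HasDerivAt s (logField f₁ f₂ Φ Lhat (s t)) t) :
    Tendsto (fun t i => Real.exp (s t i)) atTop (𝓝 k) := by
  rw [tendsto_pi_nhds]
  intro i
  rw [tendsto_order]
  refine ⟨fun a ha => ?_, fun b hb => ?_⟩
  · by_cases hi : i ∈ I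
    swap
    · exact Eventually.of_forall fun t => (ha.trans_eq (hk.2 i hi)).trans (Real.exp_pos _)
    obtain ⟨c, ⟨hca, hc1⟩, hc0⟩ : ∃ c, (a < c * k i ∧ c < 1) ∧ 0 < c := by
      have : Tendsto (fun c => c * k i) (𝓝[<] 1) (𝓝 (k i)) := by
        have h : Continuous fun c => c * k i := by fun_prop
        simpa using (h.tendsto 1).mono_left (nhdsWithin_le_nhds (s := Iio 1))
      exact (((this.eventually_const_lt ha).and self_mem_nhdsWithin).and
        ((tendsto_id.mono_left nhdsWithin_le_nhds).eventually_const_lt zero_lt_one)).exists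
    have hmem : c • k ∈ stratum I :=
      ⟨fun j hj => mul_pos hc0 (hk.1 j hj), fun j hj => by simp [hk.2 j hj]⟩
    refine eventually_gt_of_curvatureFormula_lt hΦ hE hs hmem (fun j hj => ?_) hi hca
    have h := curvatureFormula_lt_scale (f₁ := f₁) (f₂ := f₂) hΦ (k := c • k) (i := j) (fun q => ?_)
      (hmem.1 j hj) (hE j) (one_lt_inv₀ hc0 |>.2 hc1)
    · rwa [smul_smul, inv_mul_cancel₀ hc0.ne', one_smul, hkL] at h
    · by_cases hq : q ∈ I
      · exact (hmem.1 q hq).le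
      · exact (hmem.2 q hq).ge
  · obtain ⟨l, hl, hlL, hlb⟩ := exists_strict_supersolution hΦ hE hL hk hkL hb
    exact eventually_lt_of_lt_curvatureFormula hΦ hE hs hl hlL hlb

theorem exists_integralCurve_logField [Fintype F] (hΦ : ∀ e, Φ e ∈ Ioo 0 (Real.pi / 2))
    (s₀ : F → ℝ) :
    ∃ s : ℝ → F → ℝ, s 0 = s₀ ∧ ∀ t, HasDerivAt s (logField f₁ f₂ Φ Lhat (s t)) t := by
  obtain ⟨M, hM⟩ := exists_norm_logField_le (f₁ := f₁) (f₂ := f₂) (Lhat := Lhat) hΦ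
  exact exists_forall_hasDerivAt_of_lipschitzWith (lipschitzWith_logField hΦ) hM s₀

/-- The combinatorial form of the main theorem, for faces which all have edges. -/
theorem exists_metric_and_flow [Fintype F] (hΦ : ∀ e, Φ e ∈ Ioo 0 (Real.pi / 2))
    (hE : ∀ i, ∃ e, f₁ e = i ∨ f₂ e = i) (hI : I ≠ Finset.univ)
    (hL : Lhat ∈ prescribedCurvatures f₁ f₂ Φ I) :
    ∃ khat : F → ℝ,
      (IsDegenerated khat ∧ totalCurvature f₁ f₂ Φ khat = Lhat) ∧
      (∀ k', IsDegenerated k' → totalCurvature f₁ f₂ Φ k' = Lhat → k' = khat) ∧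
      khat ∈ stratum I ∧
      ∀ k₀ : F → ℝ, (∀ i, 0 < k₀ i) →
        ∃ k : ℝ → F → ℝ, k 0 = k₀ ∧ IsFlowOn f₁ f₂ Φ I Lhat (Ici 0) k ∧
          (∀ (T : ℝ) (k' : ℝ → F → ℝ), k' 0 = k₀ →
            IsFlowOn f₁ f₂ Φ I Lhat (Ico 0 T) k' → EqOn k' k (Ico 0 T)) ∧
          Tendsto k atTop (𝓝 khat) := by
  obtain ⟨m, hm, hmL⟩ := exists_mem_stratum_curvatureFormula_eq hΦ hL
  have hm0 : ∀ i, 0 ≤ m i := fun i => by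
    by_cases hi : i ∈ I
    · exact (hm.1 i hi).le
    · exact (hm.2 i hi).ge
  obtain ⟨j, hj⟩ : ∃ j, j ∉ I := by
    by_contra! h
    exact hI (Finset.eq_univ_iff_forall.2 h)
  refine ⟨m, ⟨⟨hm0, j, hm.2 j hj⟩, funext fun i => (totalCurvature_eq hΦ hm0 i).trans (hmL i)⟩,
    fun k' hk' hkL => ?_, hm, fun k₀ hk₀ => ?_⟩
  · have hkL' : ∀ i, curvatureFormula f₁ f₂ Φ k' i = Lhat i := fun i => by
      rw [← totalCurvature_eq hΦ hk'.1, hkL]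
    -- Since every face has an edge, L_i vanishes exactly when k_i does, so the support of Lhat
    -- determines the stratum.
    have hkI : k' ∈ stratum I := by
      refine ⟨fun i hi => (hk'.1 i).lt_of_ne fun h => ?_, fun i hi => ?_⟩
      · have := hL.1 i hi
        rw [← hkL' i, curvatureFormula_eq_zero h.symm] at this
        exact this.false
      · by_contra h
        have := curvatureFormula_pos (f₁ := f₁) (f₂ := f₂) (Φ := Φ)
          ((hk'.1 i).lt_of_ne (Ne.symm h)) (hE i)
        rw [hkL' i, hL.2.1 i hi] at this
        exact this.false
    -- Both metrics are limits of the same trajectory; its initial value is arbitrary.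
    obtain ⟨s, -, hs⟩ := exists_integralCurve_logField (f₁ := f₁) (f₂ := f₂) (Lhat := Lhat) hΦ 0
    exact tendsto_nhds_unique (tendsto_exp_of_curvatureFormula_eq hΦ hE hL.2.1 hkI hkL' hs)
      (tendsto_exp_of_curvatureFormula_eq hΦ hE hL.2.1 hm hmL hs)
  · obtain ⟨s, hs0, hs⟩ := exists_integralCurve_logField (f₁ := f₁) (f₂ := f₂) (Lhat := Lhat) hΦ
      fun i => Real.log (k₀ i)
    have h0 : (fun i => Real.exp (s 0 i)) = k₀ := by
      rw [hs0]
      exact funext fun i => Real.exp_log (hk₀ i)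
    exact ⟨fun t i => Real.exp (s t i), h0, isFlowOn_exp hΦ hL.2.1 hs _,
      fun T k' hk' hflow => hflow.eqOn hΦ hL.2.1 (isFlowOn_exp hΦ hL.2.1 hs _) (hk'.trans h0.symm),
      tendsto_exp_of_curvatureFormula_eq hΦ hE hL.2.1 hm hmL hs⟩

end

end CirclePattern

theorem theorem1p9 {S : Type*} [TopologicalSpace S] [T2Space S] [CompactSpace S] [ConnectedSpace S]
    [ChartedSpace (EuclideanSpace ℝ (Fin 2)) S]
    [CWComplex (univ : Set S)] [∀ n, Fintype (RelCWComplex.cell (univ : Set S) n)]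
    (hdim : ∀ n, 2 < n → IsEmpty (RelCWComplex.cell (univ : Set S) n))
    [DecidableEq (CirclePattern.Faces S)]
    (f₁ f₂ : CirclePattern.Edges S → CirclePattern.Faces S)
    (hsides : ∀ e, CirclePattern.LieOnTwoSides e (f₁ e) (f₂ e))
    (Φ : CirclePattern.Edges S → ℝ) (hΦ : ∀ e, Φ e ∈ Ioo 0 (Real.pi / 2))
    (I : Finset (CirclePattern.Faces S)) (hI : I.Nonempty) (hI' : I ≠ Finset.univ)
    (Lhat : CirclePattern.Faces S → ℝ)
    (hL : Lhat ∈ CirclePattern.prescribedCurvatures f₁ f₂ Φ I) :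
    ∃ khat : CirclePattern.Faces S → ℝ,
      (CirclePattern.IsDegenerated khat ∧ CirclePattern.totalCurvature f₁ f₂ Φ khat = Lhat) ∧
      (∀ k', CirclePattern.IsDegenerated k' →
        CirclePattern.totalCurvature f₁ f₂ Φ k' = Lhat → k' = khat) ∧
      khat ∈ CirclePattern.stratum I ∧
      ∀ k₀ : CirclePattern.Faces S → ℝ, (∀ i, 0 < k₀ i) →
        ∃ k : ℝ → CirclePattern.Faces S → ℝ,
          k 0 = k₀ ∧
          CirclePattern.IsFlowOn f₁ f₂ Φ I Lhat (Ici 0) k ∧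
          (∀ (T : ℝ) (k' : ℝ → CirclePattern.Faces S → ℝ), k' 0 = k₀ →
            CirclePattern.IsFlowOn f₁ f₂ Φ I Lhat (Ico 0 T) k' → EqOn k' k (Ico 0 T)) ∧
          Tendsto k atTop (𝓝 khat) := by
  obtain ⟨a, ha⟩ := hI
  obtain ⟨b, hb⟩ : ∃ b, b ∉ I := by
    by_contra! h
    exact hI' (Finset.eq_univ_iff_forall.2 h)
  -- One face inside I and one outside supply the second face that the topological argument needs.
  have hE : ∀ i, ∃ e, f₁ e = i ∨ f₂ e = i := fun i => by
    by_cases hi : i = a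
    · exact CirclePattern.exists_edge_of_face hdim hsides (j := b) fun h => hb (h ▸ hi ▸ ha)
    · exact CirclePattern.exists_edge_of_face hdim hsides hi
  exact CirclePattern.exists_metric_and_flow hΦ hE hI' hL
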